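/- Let $\lambda\in\mathbb R$ and $\gamma\in(0,2)$ with $\gamma\ge\lambda^2/3$. Consider the planar system (flat FLRW cosmology with scalar-field potential $V=V_0e^{-\lambda\varphi}$, $V_0>0$, and a perfect fluid $p_{\rm pf}=(\gamma-1)\rho_{\rm pf}$; $'=d/dN$, $N$ the $e$-fold time) $$\Sigma_\varphi'=-(2-q)\Sigma_\varphi+\sqrt{\tfrac32}\,\lambda\,\Omega_V,\qquad \Omega_{\rm pf}'=[2(1+q)-3\gamma]\,\Omega_{\rm pf},$$ where $\Omega_V=1-\Sigma_\varphi^2-\Omega_{\rm pf}$ and $q=-1+3\Sigma_\varphi^2+\tfrac32\gamma\,\Omega_{\rm pf}$. In the plane of $(\Sigma_\varphi,\Omega_{\rm pf})$ put $\mathrm K_\pm=(\pm1,0)$, $\mathrm{FL}=(0,1)$, $\mathrm P=(\lambda/\sqrt6,0)$, $\mathrm{dS}=(0,0)$ and, for $\lambda\neq0$, $\mathrm S=\bigl(\sqrt{3/2}\,\gamma/\lambda,\;1-3\gamma/\lambda^2\bigr)$. An interior orbit is the trajectory of a solution, defined for all $N\in\mathbb R$, that stays in the interior $\{\Omega_V>0,\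 \Omega_{\rm pf}>0\}$; it ends at (originates from) a point if the solution tends to that point as $N\to+\infty$ ($N\to-\infty$). Through each point of the interior passes exactly one interior orbit, and: (i) Every interior orbit ends at $\mathrm P$; here $\mathrm P=\mathrm{dS}$ when $\lambda=0$, and $\mathrm P=\mathrm S$ when $\gamma=\lambda^2/3$. (ii) Exactly one interior orbit originates from $\mathrm{FL}$. (iii) Every other interior orbit originates from $\mathrm K_-$ or from $\mathrm K_+$, and for each of $\mathrm K_-$ and $\mathrm K_+$ the interior orbits that originate from it form a 1-parameter set: there is a continuous curve $c:\mathbb R\to\mathbb R^2$ each of whose points lies on such an orbit, and each such orbit contains $c(s)$ for exactly one $s\in\mathbb R$. -/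

import Mathlib

open Filter Topology

noncomputable section

namespace ScalarFluid

/-- States `(Σ_φ, Ω_pf)`. -/
abbrev State : Type := ℝ × ℝ

/-- `Ω_V = 1 - Σ_φ² - Ω_pf`. -/
def OmegaV (p : State) : ℝ := 1 - p.1 ^ 2 - p.2

/-- The deceleration parameter `q = -1 + 3 Σ_φ² + (3/2) γ Ω_pf`. -/
def decel (gam : ℝ) (p : State) : ℝ := -1 + 3 * p.1 ^ 2 + 3 / 2 * gam * p.2

/-- The right-hand side of the planar system for `(Σ_φ, Ω_pf)` in e-fold time `N`. -/
def field (lam gam : ℝ) (p : State) : State :=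
  (-(2 - decel gam p) * p.1 + √(3 / 2) * lam * OmegaV p,
    (2 * (1 + decel gam p) - 3 * gam) * p.2)

/-- The interior state space `Ω_V > 0`, `Ω_pf > 0`. -/
def interiorStates : Set State := {p | 0 < OmegaV p ∧ 0 < p.2}

/-- A solution of the system defined for all e-fold times `N ∈ ℝ`. -/
def IsSolution (lam gam : ℝ) (x : ℝ → State) : Prop :=
  IsIntegralCurve x (fun _ => field lam gam)

/-- An interior orbit: the trajectory of a complete solution that stays in the interior. -/
def IsInteriorOrbit (lam gam : ℝ) (O : Set State) : Prop :=
  O ⊆ interiorStates ∧ ∃ x : ℝ → State, IsSolution lam gam x ∧ Set.range x = O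

/-- The orbit `O` ends at `p`: it is traced out by a solution that tends to `p` as `N → +∞`. -/
def EndsAt (lam gam : ℝ) (O : Set State) (p : State) : Prop :=
  ∃ x : ℝ → State, IsSolution lam gam x ∧ Set.range x = O ∧ Tendsto x atTop (𝓝 p)

/-- The orbit `O` originates from `p`: it is traced out by a solution that tends to `p` as
`N → -∞`. -/
def OriginatesFrom (lam gam : ℝ) (O : Set State) (p : State) : Prop :=
  ∃ x : ℝ → State, IsSolution lam gam x ∧ Set.range x = O ∧ Tendsto x atBot (𝓝 p)

/-- A set of orbits is a 1-parameter set if there is a continuous curve in the state space, with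
parameter in an open interval (here the whole real line), each point of which lies on an orbit of
the set, and which meets every orbit of the set at exactly one parameter value. -/
def IsOneParameterSet (𝒪 : Set (Set State)) : Prop :=
  ∃ c : ℝ → State, Continuous c ∧ (∀ s, ∃ O ∈ 𝒪, c s ∈ O) ∧ ∀ O ∈ 𝒪, ∃! s, c s ∈ O

/-- The kinaton point `K₊`. -/
def Kplus : State := (1, 0)

/-- The kinaton point `K₋`. -/
def Kminus : State := (-1, 0)

/-- The Friedmann–Lemaître point. -/
def FL : State := (0, 1)

/-- The power-law point `P`. -/
def P (lam : ℝ) : State := (lam / √6, 0)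

/-- The de Sitter point. -/
def dS : State := (0, 0)

/-- The scaling point `S` (for `λ ≠ 0`). -/
def S (lam gam : ℝ) : State := (√(3 / 2) * (gam / lam), 1 - 3 * gam / lam ^ 2)

end ScalarFluid

end

/-! Write v = λ/√6 and Σ, Ω for the coordinates. The function Z = Ω_V/(1 - vΣ)² satisfies Z' = Z·r,
where r ≥ 0 because γ ≥ λ²/3 = 2v², and its maximum 1/(1 - v²) is attained at P. Along interior
solutions Z is strictly increasing. If Z has a positive limit in either time direction, Barbalat's
lemma gives r → 0 and then convergence to P (`tendsto_P`). Towards the future the limit is positive,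
which is (i). Towards the past, convergence to P would start Z at its maximum, so Z → 0 and hence
Ω_V → 0.

For the past limits, fix m < 1 above |v| and √(γ/2). A solution that once has |Σ| > m is trapped
there backwards in time and comes from K₊ or K₋ (`tendsto_kinaton`). A solution that never does has
Σ → 0 and comes from FL (`tendsto_atBot_trichotomy`).

FL is a saddle. For two solutions from FL, aligned at a common level of Z, the form δΣ² - K δΩ² does
not increase from its limit 0 at -∞, so the separation lies in a cone around the Ω-direction. Near
FL, points of one level of Z are separated almost along Σ, so the separation vanishes
(`exists_eq_of_tendsto_FL`).

An orbit from FL exists by connectedness. Every orbit meets the level Z = 1/2 exactly once, and the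
interior part of that level is a graph over an open interval of Σ. Orbits cannot cross, so their
order by Σ is the same on all levels (`fst_lt_of_fst_lt`). Hence the orbits from K₋ fill an initial
segment without maximum, those from K₊ lie above it without minimum, and the point between them
comes from FL (`exists_sourceSet_eq`). The two remaining open intervals parametrize the sets in
(iii). -/

section GlobalExistence

/-! ### Complete integral curves and Barbalat's lemma. -/

open Set NNReal

variable {E : Type*} [NormedAddCommGroup E] [NormedSpace ℝ E] [CompleteSpace E]

/-- A bounded, globally Lipschitz vector field has an integral curve on every interval `[-T, T]`. -/
theorem exists_integralCurve_Icc_of_lipschitz_bounded {F : E → E} {K M : ℝ≥0}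
    (hF : LipschitzWith K F) (hM : ∀ p, ‖F p‖ ≤ M) (p : E) (T : ℝ) (hT : 0 ≤ T) :
    ∃ α : ℝ → E, α 0 = p ∧ ∀ t ∈ Ioo (-T) T, HasDerivAt α (F (α t)) t := by
  have h0 : (0 : ℝ) ∈ Icc (-T) T := ⟨by linarith, hT⟩
  -- A curve of speed at most M stays within distance M·T of its start during time T, so that radius
  -- suffices.
  have hPL : IsPicardLindelof (fun _ ↦ F) (⟨0, h0⟩ : Icc (-T) T) p (M * ⟨T, hT⟩) 0 M K :=
    IsPicardLindelof.of_time_independent (fun x _ ↦ hM x) hF.lipschitzOnWith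
      (by simp [show ((M * ⟨T, hT⟩ : ℝ≥0) : ℝ) = M * T from rfl])
  obtain ⟨α, hα0, hα⟩ := hPL.exists_eq_forall_mem_Icc_hasDerivWithinAt₀
  exact ⟨α, hα0, fun t ht ↦
    (hα t (Ioo_subset_Icc_self ht)).hasDerivAt (Icc_mem_nhds ht.1 ht.2)⟩

/-- A bounded, globally Lipschitz vector field has complete integral curves. -/
theorem exists_integralCurve_of_lipschitz_bounded {F : E → E} {K M : ℝ≥0}
    (hF : LipschitzWith K F) (hM : ∀ p, ‖F p‖ ≤ M) (p : E) :
    ∃ α : ℝ → E, α 0 = p ∧ ∀ t, HasDerivAt α (F (α t)) t := by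
  choose α hα0 hα using fun n : ℕ ↦
    exists_integralCurve_Icc_of_lipschitz_bounded hF hM p (n + 1) (by positivity)
  have agree : ∀ m n : ℕ, m ≤ n → ∀ t ∈ Ioo (-(m + 1 : ℝ)) (m + 1), α m t = α n t := by
    intro m n hmn
    have hmn' : (m : ℝ) ≤ n := by exact_mod_cast hmn
    have hm : (0 : ℝ) ≤ m := m.cast_nonneg
    refine ODE_solution_unique_of_mem_Ioo (v := fun _ ↦ F) (s := fun _ ↦ univ) (t₀ := 0)
      (fun _ _ ↦ hF.lipschitzOnWith) ⟨by linarith, by linarith⟩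
      (fun t ht ↦ ⟨hα m t ht, mem_univ _⟩)
      (fun t ht ↦ ⟨hα n t ⟨by linarith [ht.1], by linarith [ht.2]⟩, mem_univ _⟩) ?_
    rw [hα0, hα0]
  -- The local curves agree where they overlap, so they glue; near t the glued curve is the single
  -- curve α n with n > |t|.
  refine ⟨fun t ↦ α ⌈|t|⌉₊ t, hα0 _, fun t ↦ ?_⟩
  have key : ∀ (n : ℕ) (s : ℝ), |s| < n → α ⌈|s|⌉₊ s = α n s := by
    intro n s hs
    have h1 := Nat.le_ceil |s|
    have h2 := abs_le.1 h1
    exact agree _ n (Nat.ceil_le.2 hs.le) s ⟨by linarith, by linarith⟩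
  obtain ⟨n, hn⟩ := exists_nat_gt |t|
  have hn' := abs_lt.1 hn
  have hd := hα n t ⟨by linarith, by linarith⟩
  rw [← key n t hn] at hd
  refine hd.congr_of_eventuallyEq ?_
  filter_upwards [(continuous_abs.continuousAt (x := t)).eventually_lt_const hn] with s hs
  exact key n s hs

end GlobalExistence

/-- **Barbalat's lemma**, along any translation invariant filter on `ℝ`. -/
theorem tendsto_deriv_zero_of_uniformContinuous {f g : ℝ → ℝ} {l : Filter ℝ} {a : ℝ}
    (hl : ∀ δ, Tendsto (· + δ) l l) (hf : ∀ t, HasDerivAt f (g t) t)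
    (hg : UniformContinuous g) (hfa : Tendsto f l (𝓝 a)) : Tendsto g l (𝓝 0) := by
  rw [Metric.tendsto_nhds]
  intro ε hε
  obtain ⟨δ, hδ, hgδ⟩ := Metric.uniformContinuous_iff.1 hg (ε / 2) (by positivity)
  have hdiff : Tendsto (fun t ↦ f (t + δ / 2) - f t) l (𝓝 0) := by
    simpa using (hfa.comp (hl (δ / 2))).sub hfa
  filter_upwards [(Metric.tendsto_nhds.1 hdiff) (ε / 2 * (δ / 2)) (by positivity)] with t ht
  -- On [t, t + δ/2] the derivative g differs from g t by at most ε/2, so f increases by g t · δ/2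
  -- up to an error ε/2 · δ/2. The increment itself is below ε/2 · δ/2, which leaves |g t| < ε.
  have hmv := (convex_Icc t (t + δ / 2)).norm_image_sub_le_of_norm_hasDerivWithin_le
    (f := fun s ↦ f s - g t * s) (f' := fun s ↦ g s - g t) (C := ε / 2)
    (x := t) (y := t + δ / 2)
    (fun s _ ↦ by
      simpa only [mul_one, id] using
        ((hf s).fun_sub ((hasDerivAt_id s).const_mul (g t))).hasDerivWithinAt)
    (fun s hs ↦ by
      rw [← dist_eq_norm]
      refine (hgδ ?_).le
      rw [Real.dist_eq, abs_lt]
      constructor <;> linarith [hs.1, hs.2])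
    ⟨le_rfl, by linarith⟩ ⟨by linarith, le_rfl⟩
  rw [Real.norm_eq_abs, Real.norm_eq_abs] at hmv
  rw [dist_zero_right, Real.norm_eq_abs] at ht ⊢
  rw [show t + δ / 2 - t = δ / 2 by ring, abs_of_pos (show 0 < δ / 2 by positivity)] at hmv
  have h1 := abs_le.1 hmv
  have h2 := abs_lt.1 ht
  have hδ2 : 0 < δ / 2 := by positivity
  rw [abs_lt]
  constructor
  · by_contra hc
    nlinarith
  · by_contra hc
    nlinarith

/-! ### The vector field, the state space and completeness of interior solutions. -/

namespace ScalarFluid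

open Set

/-- The `Σ_φ`-coordinate of the power-law point `P`. -/
noncomputable def slope (lam : ℝ) : ℝ := lam / √6

/-- The parameter range of the theorem, in terms of `slope lam`. -/
structure Admissible (lam gam : ℝ) : Prop where
  gam_pos : 0 < gam
  gam_lt_two : gam < 2
  slope_sq_le : 2 * slope lam ^ 2 ≤ gam

variable {lam gam : ℝ} {x y : ℝ → State} {p q : State} {t : ℝ}

theorem sqrt_mul_eq_slope (lam : ℝ) : √(3 / 2) * lam = 3 * slope lam := by
  have h6 : √(3 / 2) = 3 / √6 := by
    rw [eq_div_iff (by positivity), ← Real.sqrt_mul (by norm_num),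
      show (3 / 2 * 6 : ℝ) = 3 ^ 2 by norm_num, Real.sqrt_sq (by norm_num)]
  rw [h6, slope]
  ring

theorem slope_sq (lam : ℝ) : slope lam ^ 2 = lam ^ 2 / 6 := by
  rw [slope, div_pow, Real.sq_sqrt (by norm_num)]

theorem Admissible.mk' (hgam : gam ∈ Ioo (0 : ℝ) 2) (h : lam ^ 2 / 3 ≤ gam) :
    Admissible lam gam :=
  ⟨hgam.1, hgam.2, by rw [slope_sq]; linarith⟩

theorem Admissible.slope_sq_lt_one (h : Admissible lam gam) : slope lam ^ 2 < 1 := by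
  linarith [h.slope_sq_le, h.gam_lt_two]

theorem Admissible.abs_slope_lt_one (h : Admissible lam gam) : |slope lam| < 1 :=
  (sq_lt_one_iff_abs_lt_one _).1 h.slope_sq_lt_one

/-- Eliminating q by 1 - Σ² = Ω_V + Ω turns 2 - q into 3Ω_V + (3/2)(2 - γ)Ω, which is visibly
nonnegative on the state space. -/
theorem field_fst (lam gam : ℝ) (p : State) : (field lam gam p).1 =
    -(3 * OmegaV p + 3 / 2 * (2 - gam) * p.2) * p.1 + 3 * slope lam * OmegaV p := by
  rw [field, sqrt_mul_eq_slope]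
  simp only [decel, OmegaV]
  ring

theorem field_snd (lam gam : ℝ) (p : State) : (field lam gam p).2 =
    (6 * p.1 ^ 2 - 3 * gam * (1 - p.2)) * p.2 := by
  simp only [field, decel]
  ring

theorem contDiff_field (lam gam : ℝ) : ContDiff ℝ 1 (field lam gam) := by
  unfold field decel OmegaV
  fun_prop

theorem continuous_OmegaV : Continuous OmegaV := by
  unfold OmegaV
  fun_prop

theorem hasDerivAt_fst (h : HasDerivAt x q t) : HasDerivAt (fun s ↦ (x s).1) q.1 t :=
  (ContinuousLinearMap.fst ℝ ℝ ℝ).hasFDerivAt.comp_hasDerivAt t h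

theorem hasDerivAt_snd (h : HasDerivAt x q t) : HasDerivAt (fun s ↦ (x s).2) q.2 t :=
  (ContinuousLinearMap.snd ℝ ℝ ℝ).hasFDerivAt.comp_hasDerivAt t h

/-- The evolution of `Ω_V` along curves whose velocity is a multiple of the field. -/
theorem hasDerivAt_OmegaV {σ : ℝ} (h : HasDerivAt x (σ • field lam gam (x t)) t) :
    HasDerivAt (fun s ↦ OmegaV (x s))
      (σ * (6 * (x t).1 ^ 2 + 3 * gam * (x t).2 - 6 * slope lam * (x t).1) * OmegaV (x t)) t := by
  have h1 := hasDerivAt_fst h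
  have h2 := hasDerivAt_snd h
  refine (((hasDerivAt_const t (1 : ℝ)).fun_sub (h1.fun_pow 2)).fun_sub h2).congr_deriv ?_
  simp only [Prod.smul_fst, Prod.smul_snd, smul_eq_mul, field_fst, field_snd, OmegaV]
  push_cast
  ring

/-- The closed state space. -/
def closedStates : Set State := {p | 0 ≤ OmegaV p ∧ 0 ≤ p.2}

theorem isClosed_closedStates : IsClosed closedStates :=
  (isClosed_le continuous_const continuous_OmegaV).inter
    (isClosed_le continuous_const continuous_snd)

theorem isOpen_interiorStates : IsOpen interiorStates :=
  (isOpen_lt continuous_const continuous_OmegaV).inter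
    (isOpen_lt continuous_const continuous_snd)

theorem interiorStates_subset : interiorStates ⊆ closedStates :=
  fun _ hp ↦ ⟨hp.1.le, hp.2.le⟩

theorem sq_fst_le_one (hp : p ∈ closedStates) : p.1 ^ 2 ≤ 1 := by
  have := hp.1
  have := hp.2
  unfold OmegaV at *
  linarith

theorem abs_fst_le_one (hp : p ∈ closedStates) : |p.1| ≤ 1 :=
  (sq_le_one_iff_abs_le_one _).1 (sq_fst_le_one hp)

theorem snd_le_one (hp : p ∈ closedStates) : p.2 ≤ 1 := by
  have := hp.1
  unfold OmegaV at *
  nlinarith [sq_nonneg p.1]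

/-- A box that contains the closed state space. -/
def box : Set State := Icc ((-1, -1) : State) (1, 1)

theorem closedStates_subset_box : closedStates ⊆ box := by
  intro p hp
  have h1 := abs_le.1 (abs_fst_le_one hp)
  exact ⟨⟨h1.1, by linarith [hp.2]⟩, ⟨h1.2, snd_le_one hp⟩⟩

theorem isCompact_closedStates : IsCompact closedStates :=
  isCompact_Icc.of_isClosed_subset isClosed_closedStates closedStates_subset_box

theorem exists_lipschitzOnWith_field (lam gam : ℝ) :
    ∃ K, LipschitzOnWith K (field lam gam) box :=
  (contDiff_field lam gam).locallyLipschitz.locallyLipschitzOn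
    |>.exists_lipschitzOnWith_of_compact isCompact_Icc

/-- The retraction of the plane onto `box`. -/
noncomputable def clamp (p : State) : State := (max (-1) (min 1 p.1), max (-1) (min 1 p.2))

theorem clamp_mem (p : State) : clamp p ∈ box :=
  ⟨⟨le_max_left _ _, le_max_left _ _⟩,
    ⟨max_le (by norm_num) (min_le_left _ _), max_le (by norm_num) (min_le_left _ _)⟩⟩

theorem clamp_of_mem (hp : p ∈ box) : clamp p = p := by
  obtain ⟨⟨h1, h2⟩, ⟨h3, h4⟩⟩ := hp
  ext
  · exact (congrArg _ (min_eq_right h3)).trans (max_eq_right h1)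
  · exact (congrArg _ (min_eq_right h4)).trans (max_eq_right h2)

theorem lipschitzWith_clamp : LipschitzWith 1 clamp := by
  have h : LipschitzWith 1 fun s : ℝ ↦ max (-1) (min 1 s) :=
    (LipschitzWith.id.const_min 1).const_max (-1)
  have h2 := (h.comp (LipschitzWith.prod_fst (α := ℝ) (β := ℝ))).prodMk
    (h.comp (LipschitzWith.prod_snd (α := ℝ) (β := ℝ)))
  rw [mul_one, max_self] at h2
  exact h2

/-- A nonnegative function with `|f'| ≤ C f` decays at most exponentially. -/
theorem pos_of_abs_deriv_le_mul {f h : ℝ → ℝ} {a b C : ℝ} (hab : a ≤ b)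
    (hf : ∀ t ∈ Icc a b, HasDerivAt f (h t * f t) t) (hC : ∀ t ∈ Icc a b, |h t| ≤ C)
    (h0 : ∀ t ∈ Icc a b, 0 ≤ f t) (ha : 0 < f a) : 0 < f b := by
  have hd : ∀ t ∈ Icc a b, HasDerivAt (fun t ↦ f t * Real.exp (C * t))
      (h t * f t * Real.exp (C * t) + f t * (Real.exp (C * t) * C)) t := fun t ht ↦
    (hf t ht).fun_mul (by simpa using ((hasDerivAt_id t).const_mul C).exp)
  have hmono : MonotoneOn (fun t ↦ f t * Real.exp (C * t)) (Icc a b) := by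
    refine monotoneOn_of_hasDerivWithinAt_nonneg (convex_Icc a b)
      (HasDerivAt.continuousOn hd) (fun t ht ↦ (hd t (interior_subset ht)).hasDerivWithinAt) ?_
    intro t ht
    have ht' := interior_subset ht
    have h1 := (abs_le.1 (hC t ht')).1
    have h2 := h0 t ht'
    have h3 := Real.exp_pos (C * t)
    have : 0 ≤ (h t + C) * f t * Real.exp (C * t) :=
      mul_nonneg (mul_nonneg (by linarith) h2) h3.le
    linarith
  have hle := hmono ⟨le_rfl, hab⟩ ⟨hab, le_rfl⟩ hab
  have : 0 < f a * Real.exp (C * a) := mul_pos ha (Real.exp_pos _)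
  exact pos_of_mul_pos_left (this.trans_le hle) (Real.exp_pos _).le

/-- Curves that follow (`σ = 1`) or run against (`σ = -1`) the clamped field do not leave the
interior in finite time. -/
theorem mem_interiorStates_of_clamp (h : Admissible lam gam) {σ : ℝ} (hσ : |σ| = 1)
    (hx : ∀ t, HasDerivAt x (σ • field lam gam (clamp (x t))) t) (h0 : x 0 ∈ interiorStates)
    (ht : 0 ≤ t) : x t ∈ interiorStates := by
  by_contra hout
  have hcont : Continuous x := continuous_iff_continuousAt.2 fun t ↦ (hx t).continuousAt
  have hcpt : IsCompact (Icc 0 t ∩ x ⁻¹' interiorStatesᶜ) :=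
    isCompact_Icc.inter_right (isOpen_interiorStates.isClosed_compl.preimage hcont)
  -- At the first exit time T the curve has so far stayed in the closed state space, where clamping
  -- does nothing. There Ω_V and Ω have logarithmic derivatives bounded by 18, so both are still
  -- positive at T.
  obtain ⟨T, ⟨hT, hTout⟩, hTmin⟩ := hcpt.exists_isLeast ⟨t, ⟨ht, le_rfl⟩, hout⟩
  have hin : ∀ s ∈ Ico 0 T, x s ∈ interiorStates := by
    intro s hs
    by_contra hs'
    exact (hTmin ⟨⟨hs.1, hs.2.le.trans hT.2⟩, hs'⟩).not_gt hs.2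
  have hT0 : 0 ≠ T := by
    rintro rfl
    exact hTout h0
  have hcl : ∀ s ∈ Icc 0 T, x s ∈ closedStates := by
    have : closure (Ico 0 T) ⊆ x ⁻¹' closedStates :=
      (isClosed_closedStates.preimage hcont).closure_subset_iff.2
        fun s hs ↦ interiorStates_subset (hin s hs)
    rwa [closure_Ico hT0] at this
  have hd : ∀ s ∈ Icc 0 T, HasDerivAt x (σ • field lam gam (x s)) s := by
    intro s hs
    simpa only [clamp_of_mem (closedStates_subset_box (hcl s hs))] using hx s
  have hv := abs_lt.1 h.abs_slope_lt_one
  have hg := h.gam_pos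
  have hg2 := h.gam_lt_two
  refine hTout ⟨?_, ?_⟩
  · refine pos_of_abs_deriv_le_mul (f := fun s ↦ OmegaV (x s)) (h := fun s ↦
        σ * (6 * (x s).1 ^ 2 + 3 * gam * (x s).2 - 6 * slope lam * (x s).1))
      (C := 18) hT.1 (fun s hs ↦ hasDerivAt_OmegaV (hd s hs)) ?_
      (fun s hs ↦ (hcl s hs).1) h0.1
    intro s hs
    have h1 := sq_fst_le_one (hcl s hs)
    have h2 := abs_le.1 (abs_fst_le_one (hcl s hs))
    have h3 := snd_le_one (hcl s hs)
    have h4 := (hcl s hs).2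
    rw [abs_mul, hσ, one_mul, abs_le]
    have h5 : |slope lam * (x s).1| ≤ 1 := by
      rw [abs_mul]
      exact mul_le_one₀ h.abs_slope_lt_one.le (abs_nonneg _) (abs_fst_le_one (hcl s hs))
    have h6 := abs_le.1 h5
    constructor <;> nlinarith
  · refine pos_of_abs_deriv_le_mul (f := fun s ↦ (x s).2)
      (h := fun s ↦ σ * (6 * (x s).1 ^ 2 - 3 * gam * (1 - (x s).2))) (C := 18) hT.1
      (fun s hs ↦ ?_) ?_ (fun s hs ↦ (hcl s hs).2) h0.2
    · refine (hasDerivAt_snd (hd s hs)).congr_deriv ?_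
      rw [Prod.smul_snd, field_snd, smul_eq_mul]
      ring
    intro s hs
    have h1 := sq_fst_le_one (hcl s hs)
    have h3 := snd_le_one (hcl s hs)
    have h4 := (hcl s hs).2
    rw [abs_mul, hσ, one_mul, abs_le]
    constructor <;> nlinarith

/-- A complete solution that stays in the interior. -/
structure IsInteriorSolution (lam gam : ℝ) (x : ℝ → State) : Prop where
  isSolution : IsSolution lam gam x
  mem : ∀ t, x t ∈ interiorStates

/-- The clamped field is bounded and Lipschitz, so it has complete curves. These never leave the
interior (negative times by time reversal), so they solve the original system. -/
theorem exists_isInteriorSolution (h : Admissible lam gam) (hp : p ∈ interiorStates) :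
    ∃ x, IsInteriorSolution lam gam x ∧ x 0 = p := by
  obtain ⟨K, hK⟩ := exists_lipschitzOnWith_field lam gam
  obtain ⟨M, hM⟩ := (isCompact_Icc (a := ((-1, -1) : State)) (b := (1, 1)))
    |>.exists_bound_of_continuousOn (contDiff_field lam gam).continuous.continuousOn
  have hlip : LipschitzWith K fun p ↦ field lam gam (clamp p) := by
    have := hK.comp (lipschitzWith_clamp.lipschitzOnWith (s := univ)) fun p _ ↦ clamp_mem p
    rw [mul_one] at this
    exact lipschitzOnWith_univ.1 this
  obtain ⟨x, hx0, hx⟩ := exists_integralCurve_of_lipschitz_bounded (M := M.toNNReal) hlip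
    (fun p ↦ (hM _ (clamp_mem p)).trans (Real.le_coe_toNNReal M)) p
  have hmem : ∀ t, x t ∈ interiorStates := by
    intro t
    rcases le_total 0 t with ht | ht
    · exact mem_interiorStates_of_clamp h (σ := 1) (by simp) (fun t ↦ by simpa using hx t)
        (hx0 ▸ hp) ht
    · have := mem_interiorStates_of_clamp h (x := fun s ↦ x (-s)) (σ := -1) (t := -t) (by simp)
        (fun t ↦ by simpa [Function.comp_def] using (hx (-t)).scomp t (hasDerivAt_neg t))
        (by simpa [hx0] using hp) (by linarith)
      simpa using this
  refine ⟨x, ⟨fun t ↦ ?_, hmem⟩, hx0⟩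
  simpa only [clamp_of_mem (closedStates_subset_box (interiorStates_subset (hmem t)))] using hx t

namespace IsInteriorSolution

theorem hasDerivAt (hx : IsInteriorSolution lam gam x) (t : ℝ) :
    HasDerivAt x (field lam gam (x t)) t := hx.isSolution t

theorem continuous (hx : IsInteriorSolution lam gam x) : Continuous x :=
  continuous_iff_continuousAt.2 fun t ↦ (hx.hasDerivAt t).continuousAt

theorem mem_closed (hx : IsInteriorSolution lam gam x) (t : ℝ) : x t ∈ closedStates :=
  interiorStates_subset (hx.mem t)

theorem comp_add (hx : IsInteriorSolution lam gam x) (s : ℝ) :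
    IsInteriorSolution lam gam (fun t ↦ x (t + s)) :=
  ⟨fun t ↦ (hx.hasDerivAt (t + s)).comp_add_const t s, fun _ ↦ hx.mem _⟩

theorem eq_of_eq (hx : IsInteriorSolution lam gam x) (hy : IsInteriorSolution lam gam y)
    (h : x t = y t) : x = y := by
  obtain ⟨K, hK⟩ := exists_lipschitzOnWith_field lam gam
  exact ODE_solution_unique_univ (v := fun _ ↦ field lam gam) (s := fun _ ↦ box) (fun _ ↦ hK)
    (fun t ↦ ⟨hx.hasDerivAt t, closedStates_subset_box (hx.mem_closed t)⟩)
    (fun t ↦ ⟨hy.hasDerivAt t, closedStates_subset_box (hy.mem_closed t)⟩) h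

/-- Solutions through a common point agree up to a time shift. -/
theorem eq_shift_of_eq (hx : IsInteriorSolution lam gam x) (hy : IsInteriorSolution lam gam y)
    {s : ℝ} (h : x t = y s) : x = fun r ↦ y (r + (s - t)) :=
  hx.eq_of_eq (hy.comp_add (s - t)) (t := t) (by simpa using h)

theorem range_eq_of_eq (hx : IsInteriorSolution lam gam x) (hy : IsInteriorSolution lam gam y)
    {s : ℝ} (h : x t = y s) : range x = range y := by
  rw [hx.eq_shift_of_eq hy h]
  exact (Equiv.addRight (s - t)).surjective.range_comp y

theorem hasDerivAt_fst (hx : IsInteriorSolution lam gam x) (t : ℝ) :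
    HasDerivAt (fun s ↦ (x s).1) (-(3 * OmegaV (x t) + 3 / 2 * (2 - gam) * (x t).2) * (x t).1
      + 3 * slope lam * OmegaV (x t)) t :=
  (ScalarFluid.hasDerivAt_fst (hx.hasDerivAt t)).congr_deriv (field_fst _ _ _)

theorem hasDerivAt_snd (hx : IsInteriorSolution lam gam x) (t : ℝ) :
    HasDerivAt (fun s ↦ (x s).2) ((6 * (x t).1 ^ 2 - 3 * gam * (1 - (x t).2)) * (x t).2) t :=
  (ScalarFluid.hasDerivAt_snd (hx.hasDerivAt t)).congr_deriv (field_snd _ _ _)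

theorem hasDerivAt_OmegaV (hx : IsInteriorSolution lam gam x) (t : ℝ) :
    HasDerivAt (fun s ↦ OmegaV (x s))
      ((6 * (x t).1 ^ 2 + 3 * gam * (x t).2 - 6 * slope lam * (x t).1) * OmegaV (x t)) t := by
  simpa using ScalarFluid.hasDerivAt_OmegaV (σ := 1) (by simpa using hx.hasDerivAt t)

/-- Continuous functions of the state are uniformly continuous along interior solutions. -/
theorem uniformContinuous_comp (hx : IsInteriorSolution lam gam x) {G : State → ℝ}
    (hG : ContinuousOn G closedStates) : UniformContinuous fun t ↦ G (x t) := by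
  obtain ⟨M, hM⟩ := isCompact_closedStates.exists_bound_of_continuousOn
    (contDiff_field lam gam).continuous.continuousOn
  have hlip : LipschitzWith M.toNNReal x :=
    lipschitzWith_of_nnnorm_deriv_le (𝕜 := ℝ) (fun t ↦ (hx.hasDerivAt t).differentiableAt)
      fun t ↦ by
        rw [(hx.hasDerivAt t).deriv]
        exact (hM _ (hx.mem_closed t)).trans (Real.le_coe_toNNReal M)
  have hGu := isCompact_closedStates.uniformContinuousOn_of_continuous hG
  rw [← uniformContinuousOn_univ]
  exact hGu.comp hlip.uniformContinuous.uniformContinuousOn fun t _ ↦ hx.mem_closed t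

end IsInteriorSolution

/-! ### The Lyapunov function and the limits it forces. -/

/-- The Lyapunov function `Ω_V / (1 - λ Σ_φ / √6)²`. -/
noncomputable def lyapunov (lam : ℝ) (p : State) : ℝ := OmegaV p / (1 - slope lam * p.1) ^ 2

/-- The logarithmic growth rate of the Lyapunov function along the flow. -/
noncomputable def lyapunovRate (lam gam : ℝ) (p : State) : ℝ :=
  2 / (1 - slope lam * p.1) *
    (3 * (p.1 - slope lam) ^ 2 + 3 / 2 * (gam - 2 * slope lam ^ 2) * p.2)

theorem Admissible.abs_slope_mul_lt_one (h : Admissible lam gam) (hp : p ∈ closedStates) :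
    |slope lam * p.1| < 1 := by
  rw [abs_mul]
  exact mul_lt_one_of_nonneg_of_lt_one_left (abs_nonneg _) h.abs_slope_lt_one (abs_fst_le_one hp)

theorem Admissible.one_sub_pos (h : Admissible lam gam) (hp : p ∈ closedStates) :
    0 < 1 - slope lam * p.1 := by
  linarith [(abs_lt.1 (h.abs_slope_mul_lt_one hp)).2]

theorem Admissible.one_sub_lt_two (h : Admissible lam gam) (hp : p ∈ closedStates) :
    1 - slope lam * p.1 < 2 := by
  linarith [(abs_lt.1 (h.abs_slope_mul_lt_one hp)).1]

theorem continuousOn_lyapunov (h : Admissible lam gam) :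
    ContinuousOn (lyapunov lam) closedStates := by
  refine continuous_OmegaV.continuousOn.div (by fun_prop) fun p hp ↦ ?_
  have := h.one_sub_pos hp
  positivity

theorem continuousOn_lyapunovRate (h : Admissible lam gam) :
    ContinuousOn (lyapunovRate lam gam) closedStates :=
  (continuousOn_const.div (by fun_prop) fun p hp ↦ (h.one_sub_pos hp).ne').mul (by fun_prop)

/-- This rests on (1 - vΣ)² - (1 - v²)(1 - Σ²) = (Σ - v)². -/
theorem lyapunov_le (h : Admissible lam gam) (hp : p ∈ closedStates) :
    lyapunov lam p ≤ 1 / (1 - slope lam ^ 2) := by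
  have h1 := h.one_sub_pos hp
  have h2 := h.slope_sq_lt_one
  rw [lyapunov, div_le_div_iff₀ (by positivity) (by linarith)]
  have h3 := hp.2
  have h4 : OmegaV p ≤ 1 - p.1 ^ 2 := by
    unfold OmegaV
    linarith
  nlinarith [sq_nonneg (p.1 - slope lam)]

theorem lyapunov_pos (h : Admissible lam gam) (hp : p ∈ interiorStates) :
    0 < lyapunov lam p :=
  div_pos hp.1 (pow_pos (h.one_sub_pos (interiorStates_subset hp)) 2)

/-- Since 0 < 1 - vΣ < 2, the prefactor 2/(1 - vΣ) exceeds 1, and the bracket is nonnegative by γ ≥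
2v². -/
theorem le_lyapunovRate (h : Admissible lam gam) (hp : p ∈ closedStates) :
    3 * (p.1 - slope lam) ^ 2 + 3 / 2 * (gam - 2 * slope lam ^ 2) * p.2
      ≤ lyapunovRate lam gam p := by
  have h1 := h.one_sub_pos hp
  have h2 := h.one_sub_lt_two hp
  have h3 : 0 ≤ 3 / 2 * (gam - 2 * slope lam ^ 2) * p.2 :=
    mul_nonneg (by linarith [h.slope_sq_le]) hp.2
  refine le_mul_of_one_le_left (by positivity) ?_
  rw [le_div_iff₀ h1]
  linarith

/-- On a level set of the Lyapunov function a point is determined by `Σ_φ`. -/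
theorem snd_eq_of_lyapunov (h : Admissible lam gam) (hp : p ∈ closedStates) :
    p.2 = 1 - p.1 ^ 2 - lyapunov lam p * (1 - slope lam * p.1) ^ 2 := by
  have h1 := (h.one_sub_pos hp).ne'
  rw [lyapunov, div_mul_cancel₀ _ (pow_ne_zero 2 h1), OmegaV]
  ring

theorem eq_of_lyapunov_eq (h : Admissible lam gam) (hp : p ∈ closedStates)
    (hq : q ∈ closedStates) (hZ : lyapunov lam p = lyapunov lam q) (h1 : p.1 = q.1) : p = q := by
  ext
  · exact h1
  · rw [snd_eq_of_lyapunov h hp, snd_eq_of_lyapunov h hq, hZ, h1]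

theorem P_mem_closedStates (h : Admissible lam gam) : P lam ∈ closedStates := by
  refine ⟨?_, le_rfl⟩
  have := h.slope_sq_lt_one
  change 0 ≤ 1 - slope lam ^ 2 - 0
  linarith

theorem lyapunov_P (h : Admissible lam gam) : lyapunov lam (P lam) = 1 / (1 - slope lam ^ 2) := by
  have := h.slope_sq_lt_one
  have h1 : 1 - slope lam ^ 2 ≠ 0 := by linarith
  change (1 - slope lam ^ 2 - 0) / (1 - slope lam * slope lam) ^ 2 = _
  rw [← pow_two, sub_zero]
  field_simp

namespace IsInteriorSolution

theorem hasDerivAt_lyapunov (h : Admissible lam gam) (hx : IsInteriorSolution lam gam x) (t : ℝ) :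
    HasDerivAt (fun s ↦ lyapunov lam (x s))
      (lyapunov lam (x t) * lyapunovRate lam gam (x t)) t := by
  have h1 := (h.one_sub_pos (hx.mem_closed t)).ne'
  have hD := ((hasDerivAt_const t (1 : ℝ)).fun_sub
    ((hx.hasDerivAt_fst t).const_mul (slope lam))).fun_pow 2
  refine ((hx.hasDerivAt_OmegaV t).fun_div hD (pow_ne_zero 2 h1)).congr_deriv ?_
  rw [lyapunov, lyapunovRate, div_mul_eq_mul_div 2, div_mul_div_comm,
    div_eq_div_iff (pow_ne_zero 2 (pow_ne_zero 2 h1)) (mul_ne_zero (pow_ne_zero 2 h1) h1)]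
  unfold OmegaV
  push_cast
  ring

theorem lyapunovRate_nonneg (h : Admissible lam gam) (hx : IsInteriorSolution lam gam x) (t : ℝ) :
    0 ≤ lyapunovRate lam gam (x t) := by
  refine le_trans ?_ (le_lyapunovRate h (hx.mem_closed t))
  have h3 : 0 ≤ 3 / 2 * (gam - 2 * slope lam ^ 2) * (x t).2 :=
    mul_nonneg (by linarith [h.slope_sq_le]) (hx.mem t).2.le
  positivity

theorem continuous_lyapunov (h : Admissible lam gam) (hx : IsInteriorSolution lam gam x) :
    Continuous fun t ↦ lyapunov lam (x t) :=
  continuous_iff_continuousAt.2 fun t ↦ (hx.hasDerivAt_lyapunov h t).continuousAt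

theorem monotone_lyapunov (h : Admissible lam gam) (hx : IsInteriorSolution lam gam x) :
    Monotone fun t ↦ lyapunov lam (x t) :=
  monotone_of_hasDerivAt_nonneg (fun t ↦ hx.hasDerivAt_lyapunov h t)
    fun t ↦ mul_nonneg (lyapunov_pos h (hx.mem t)).le (hx.lyapunovRate_nonneg h t)

theorem strictMono_lyapunov (h : Admissible lam gam) (hx : IsInteriorSolution lam gam x) :
    StrictMono fun t ↦ lyapunov lam (x t) := by
  have hmono := hx.monotone_lyapunov h
  intro a b hab
  refine lt_of_le_of_ne (hmono hab.le) fun heq ↦ ?_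
  -- Equal values at a and b make Z constant in between, so the rate vanishes and Σ = v there. Then
  -- 0 = Σ' = -(3/2)(2 - γ)Ωv forces v = 0, and the other term γΩ of the rate cannot vanish.
  have hconst : ∀ t ∈ Ioo a b, lyapunov lam (x t) = lyapunov lam (x a) := fun t ht ↦
    le_antisymm ((hmono ht.2.le).trans heq.ge) (hmono ht.1.le)
  have hrate : ∀ t ∈ Ioo a b,
      (x t).1 = slope lam ∧ (gam - 2 * slope lam ^ 2) * (x t).2 = 0 := by
    intro t ht
    have hev : (fun s ↦ lyapunov lam (x s)) =ᶠ[𝓝 t] fun _ ↦ lyapunov lam (x a) := by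
      filter_upwards [isOpen_Ioo.mem_nhds ht] with s hs using hconst s hs
    have hz := (hx.hasDerivAt_lyapunov h t).unique
      ((hasDerivAt_const t (lyapunov lam (x a))).congr_of_eventuallyEq hev)
    have hr := (mul_eq_zero.1 hz).resolve_left (lyapunov_pos h (hx.mem t)).ne'
    have hle := le_lyapunovRate h (hx.mem_closed t)
    have h3 : 0 ≤ (gam - 2 * slope lam ^ 2) * (x t).2 :=
      mul_nonneg (by linarith [h.slope_sq_le]) (hx.mem t).2.le
    have h4 := sq_nonneg ((x t).1 - slope lam)
    refine ⟨sub_eq_zero.1 (pow_eq_zero_iff two_ne_zero |>.1 ?_), ?_⟩ <;> linarith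
  obtain ⟨t, ht⟩ := nonempty_Ioo.2 hab
  have hy := (hx.mem t).2
  have hev : (fun s ↦ (x s).1) =ᶠ[𝓝 t] fun _ ↦ slope lam := by
    filter_upwards [isOpen_Ioo.mem_nhds ht] with s hs using (hrate s hs).1
  have hz := (hx.hasDerivAt_fst t).unique
    ((hasDerivAt_const t (slope lam)).congr_of_eventuallyEq hev)
  rw [(hrate t ht).1] at hz
  have hg := (mul_eq_zero.1 (hrate t ht).2).resolve_right hy.ne'
  have h5 : (2 - gam) * (x t).2 * slope lam = 0 := by linarith
  have h6 : (2 - gam) * (x t).2 ≠ 0 := (mul_pos (by linarith [h.gam_lt_two]) hy).ne'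
  have h7 := (mul_eq_zero.1 h5).resolve_left h6
  rw [h7] at hg
  linarith [h.gam_pos]

/-- Where the Lyapunov function has a positive limit, the solution converges to `P`. -/
theorem tendsto_P (h : Admissible lam gam) (hx : IsInteriorSolution lam gam x) {l : Filter ℝ}
    (hl : ∀ δ, Tendsto (· + δ) l l) {ℓ : ℝ} (hℓ : 0 < ℓ)
    (hZ : Tendsto (fun t ↦ lyapunov lam (x t)) l (𝓝 ℓ)) : Tendsto x l (𝓝 (P lam)) := by
  have hrate : Tendsto (fun t ↦ lyapunovRate lam gam (x t)) l (𝓝 0) := by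
    have h1 := tendsto_deriv_zero_of_uniformContinuous hl (hx.hasDerivAt_lyapunov h)
      (hx.uniformContinuous_comp ((continuousOn_lyapunov h).mul (continuousOn_lyapunovRate h))) hZ
    have h2 := h1.div hZ hℓ.ne'
    rw [zero_div] at h2
    refine h2.congr fun t ↦ ?_
    exact mul_div_cancel_left₀ _ (lyapunov_pos h (hx.mem t)).ne'
  have hnn : ∀ t, 0 ≤ (gam - 2 * slope lam ^ 2) * (x t).2 := fun t ↦
    mul_nonneg (by linarith [h.slope_sq_le]) (hx.mem t).2.le
  have hdiff : Tendsto (fun t ↦ (x t).1 - slope lam) l (𝓝 0) := by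
    have h1 : Tendsto (fun t ↦ ((x t).1 - slope lam) ^ 2) l (𝓝 0) :=
      squeeze_zero (fun t ↦ sq_nonneg _) (fun t ↦ by
        have := le_lyapunovRate h (hx.mem_closed t)
        nlinarith [hnn t, sq_nonneg ((x t).1 - slope lam)]) hrate
    have h2 := h1.sqrt
    simp only [Real.sqrt_sq_eq_abs, Real.sqrt_zero] at h2
    exact (tendsto_zero_iff_abs_tendsto_zero _).2 h2
  have hfst : Tendsto (fun t ↦ (x t).1) l (𝓝 (slope lam)) := by
    simpa using hdiff.add_const (slope lam)
  have hsnd : Tendsto (fun t ↦ (x t).2) l (𝓝 0) := by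
    rcases h.slope_sq_le.lt_or_eq with hlt | heq
    · have h1 := hrate.const_mul (gam - 2 * slope lam ^ 2)⁻¹
      rw [mul_zero] at h1
      refine squeeze_zero (fun t ↦ (hx.mem t).2.le) (fun t ↦ ?_) h1
      rw [← div_eq_inv_mul, le_div_iff₀ (by linarith)]
      have := le_lyapunovRate h (hx.mem_closed t)
      nlinarith [hnn t, sq_nonneg ((x t).1 - slope lam)]
    -- In the borderline case γ = 2v² the rate does not control Ω. A second use of Barbalat, for Σ →
    -- v, gives Σ' → 0. Since Σ' = -(3Ω_V + βΩ)(Σ - v) - βvΩ with β = (3/2)(2 - γ), it follows that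
    -- Ω → 0.
    · have hv : slope lam ≠ 0 := by
        intro h0
        rw [h0] at heq
        linarith [h.gam_pos]
      have hG : ContinuousOn (fun p : State ↦ -(3 * OmegaV p + 3 / 2 * (2 - gam) * p.2) * p.1
          + 3 * slope lam * OmegaV p) closedStates := by
        have := continuous_OmegaV
        fun_prop
      have h1 := tendsto_deriv_zero_of_uniformContinuous hl hx.hasDerivAt_fst
        (hx.uniformContinuous_comp hG) hfst
      have h2 : Tendsto (fun t ↦ (3 * OmegaV (x t) + 3 / 2 * (2 - gam) * (x t).2) *
          ((x t).1 - slope lam)) l (𝓝 0) := by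
        refine squeeze_zero_norm (a := fun t ↦ 3 * |(x t).1 - slope lam|) (fun t ↦ ?_) ?_
        · rw [Real.norm_eq_abs, abs_mul]
          refine mul_le_mul_of_nonneg_right ?_ (abs_nonneg _)
          have h3 := hx.mem t
          have h4 : OmegaV (x t) + (x t).2 ≤ 1 := by
            unfold OmegaV
            nlinarith [sq_nonneg (x t).1]
          rw [abs_le]
          constructor <;> nlinarith [h3.1, h3.2, h.gam_pos, h.gam_lt_two, mul_pos h.gam_pos h3.2]
        · simpa using hdiff.abs.const_mul 3
      have h3 := (h1.add h2).div_const (-(3 / 2 * (2 - gam) * slope lam))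
      rw [add_zero, zero_div] at h3
      refine h3.congr fun t ↦ ?_
      have h4 : 2 - gam ≠ 0 := by linarith [h.gam_lt_two]
      field_simp
      ring
  exact hfst.prodMk_nhds hsnd

theorem tendsto_lyapunov_of_tendsto_P (h : Admissible lam gam)
    (hx : IsInteriorSolution lam gam x) {l : Filter ℝ} (hl : Tendsto x l (𝓝 (P lam))) :
    Tendsto (fun t ↦ lyapunov lam (x t)) l (𝓝 (1 / (1 - slope lam ^ 2))) := by
  rw [← lyapunov_P h]
  exact ((continuousOn_lyapunov h) _ (P_mem_closedStates h)).tendsto.comp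
    (tendsto_nhdsWithin_iff.2 ⟨hl, Eventually.of_forall hx.mem_closed⟩)

theorem tendsto_P_atTop (h : Admissible lam gam) (hx : IsInteriorSolution lam gam x) :
    Tendsto x atTop (𝓝 (P lam)) := by
  have hbdd : BddAbove (range fun t ↦ lyapunov lam (x t)) :=
    ⟨_, forall_mem_range.2 fun t ↦ lyapunov_le h (hx.mem_closed t)⟩
  refine hx.tendsto_P h (fun δ ↦ tendsto_atTop_add_const_right _ _ tendsto_id)
    ?_ (tendsto_atTop_ciSup (hx.monotone_lyapunov h) hbdd)
  exact (lyapunov_pos h (hx.mem 0)).trans_le (le_ciSup hbdd 0)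

/-- A positive limit would mean convergence to P in the past; Z would then start from its maximum
and still increase strictly. -/
theorem tendsto_lyapunov_atBot (h : Admissible lam gam) (hx : IsInteriorSolution lam gam x) :
    Tendsto (fun t ↦ lyapunov lam (x t)) atBot (𝓝 0) := by
  have hbdd : BddBelow (range fun t ↦ lyapunov lam (x t)) :=
    ⟨0, forall_mem_range.2 fun t ↦ (lyapunov_pos h (hx.mem t)).le⟩
  have hlim := tendsto_atBot_ciInf (hx.monotone_lyapunov h) hbdd
  rcases (le_ciInf fun t ↦ (lyapunov_pos h (hx.mem t)).le).eq_or_lt with h0 | hpos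
  · rwa [← h0] at hlim
  · have hP := hx.tendsto_lyapunov_of_tendsto_P h (hx.tendsto_P h
      (fun δ ↦ tendsto_atBot_add_const_right _ _ tendsto_id) hpos hlim)
    have h1 := (hx.monotone_lyapunov h).le_of_tendsto hP 0
    have h2 := hx.strictMono_lyapunov h zero_lt_one
    exact absurd (lyapunov_le h (hx.mem_closed 1)) (h1.trans_lt h2).not_ge

/-- Every level of the Lyapunov function is attained along every interior solution. -/
theorem range_lyapunov (h : Admissible lam gam) (hx : IsInteriorSolution lam gam x) :
    range (fun t ↦ lyapunov lam (x t)) = Ioo 0 (1 / (1 - slope lam ^ 2)) := by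
  have hsm := hx.strictMono_lyapunov h
  refine Subset.antisymm (range_subset_iff.2 fun t ↦ ⟨lyapunov_pos h (hx.mem t), ?_⟩) ?_
  · exact (hsm (lt_add_one t)).trans_le (lyapunov_le h (hx.mem_closed _))
  · rintro c ⟨hc0, hc1⟩
    obtain ⟨a, ha⟩ := ((hx.tendsto_lyapunov_atBot h).eventually_lt_const hc0).exists
    obtain ⟨b, hb⟩ := ((hx.tendsto_lyapunov_of_tendsto_P h
      (hx.tendsto_P_atTop h)).eventually_const_lt hc1).exists
    exact mem_range_of_exists_le_of_exists_ge (hx.continuous_lyapunov h) ⟨a, ha.le⟩ ⟨b, hb.le⟩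

theorem tendsto_OmegaV_atBot (h : Admissible lam gam) (hx : IsInteriorSolution lam gam x) :
    Tendsto (fun t ↦ OmegaV (x t)) atBot (𝓝 0) := by
  have h1 := (hx.tendsto_lyapunov_atBot h).mul_const 4
  rw [zero_mul] at h1
  refine squeeze_zero (fun t ↦ (hx.mem t).1.le) (fun t ↦ ?_) h1
  have h2 := h.one_sub_pos (hx.mem_closed t)
  have h3 := h.one_sub_lt_two (hx.mem_closed t)
  have h4 := (lyapunov_pos h (hx.mem t)).le
  calc OmegaV (x t) = lyapunov lam (x t) * (1 - slope lam * (x t).1) ^ 2 := by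
        rw [lyapunov, div_mul_cancel₀ _ (by positivity)]
    _ ≤ _ := mul_le_mul_of_nonneg_left (by nlinarith) h4

end IsInteriorSolution

/-! ### Behaviour in the past: trapping regions and the trichotomy. -/

variable {m : ℝ}

/-- If `f` is nonincreasing wherever it exceeds `m`, then the region `f > m` is invariant
backwards in time and `f` is antitone there. -/
theorem antitoneOn_Iic_of_deriv_nonpos_of_gt {f f' : ℝ → ℝ} {m t₀ : ℝ}
    (hf : ∀ t, HasDerivAt f (f' t) t) (hf' : ∀ t ≤ t₀, m < f t → f' t ≤ 0) (h0 : m < f t₀) :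
    AntitoneOn f (Iic t₀) ∧ ∀ t ≤ t₀, m < f t := by
  have hcont : Continuous f := continuous_iff_continuousAt.2 fun t ↦ (hf t).continuousAt
  have hanti : ∀ s ≤ t₀, (∀ t ∈ Ioc s t₀, m < f t) → AntitoneOn f (Icc s t₀) := fun s _ h ↦
    antitoneOn_of_hasDerivWithinAt_nonpos (convex_Icc s t₀) hcont.continuousOn
      (fun t _ ↦ (hf t).hasDerivWithinAt) fun t ht ↦ by
        rw [interior_Icc] at ht
        exact hf' t ht.2.le (h t ⟨ht.1, ht.2.le⟩)
  have hgt : ∀ t ≤ t₀, m < f t := by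
    intro t ht
    by_contra hle
    have hcpt : IsCompact (Icc t t₀ ∩ f ⁻¹' Iic m) :=
      isCompact_Icc.inter_right (isClosed_Iic.preimage hcont)
    -- T is the last time with f ≤ m; since f is antitone on [T, t₀], f T ≥ f t₀ > m, a
    -- contradiction.
    obtain ⟨T, ⟨hT, hTm⟩, hTmax⟩ := hcpt.exists_isGreatest ⟨t, ⟨le_rfl, ht⟩, not_lt.1 hle⟩
    have h1 : ∀ s ∈ Ioc T t₀, m < f s := by
      intro s hs
      by_contra hs'
      exact (hTmax ⟨⟨hT.1.trans hs.1.le, hs.2⟩, not_lt.1 hs'⟩).not_gt hs.1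
    have h2 := hanti T hT.2 h1 ⟨le_rfl, hT.2⟩ ⟨hT.2, le_rfl⟩ hT.2
    exact (h0.trans_le h2).not_ge hTm
  refine ⟨fun a ha b hb hab ↦ ?_, hgt⟩
  exact hanti a ha (fun t ht ↦ hgt t ht.2) ⟨le_rfl, ha⟩ ⟨hab, hb⟩ hab

/-- Exponential decay backwards in time. -/
theorem tendsto_zero_atBot_of_le_deriv {f f' : ℝ → ℝ} {c t₀ : ℝ} (hc : 0 < c)
    (hf : ∀ t, HasDerivAt f (f' t) t) (h0 : ∀ t, 0 ≤ f t) (hf' : ∀ t ≤ t₀, c * f t ≤ f' t) :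
    Tendsto f atBot (𝓝 0) := by
  have hd : ∀ t, HasDerivAt (fun t ↦ f t * Real.exp (-c * t))
      (f' t * Real.exp (-c * t) + f t * (Real.exp (-c * t) * -c)) t := fun t ↦
    (hf t).fun_mul (by simpa using ((hasDerivAt_id t).const_mul (-c)).exp)
  have hmono : MonotoneOn (fun t ↦ f t * Real.exp (-c * t)) (Iic t₀) := by
    refine monotoneOn_of_hasDerivWithinAt_nonneg (convex_Iic t₀)
      (fun t _ ↦ (hd t).continuousAt.continuousWithinAt)
      (fun t _ ↦ (hd t).hasDerivWithinAt) fun t ht ↦ ?_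
    have h1 := hf' t (mem_Iic.1 (interior_subset ht))
    have h2 : 0 ≤ (f' t - c * f t) * Real.exp (-c * t) :=
      mul_nonneg (by linarith) (Real.exp_pos _).le
    linarith
  have hlim : Tendsto (fun t ↦ f t₀ * Real.exp (-c * t₀) * Real.exp (c * t)) atBot (𝓝 0) := by
    have := Real.tendsto_exp_atBot.comp (tendsto_id.const_mul_atBot hc)
    simpa using this.const_mul (f t₀ * Real.exp (-c * t₀))
  refine squeeze_zero' (Eventually.of_forall h0) ?_ hlim
  filter_upwards [eventually_le_atBot t₀] with t ht
  have h1 := hmono ht (mem_Iic.2 le_rfl) ht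
  calc f t = f t * Real.exp (-c * t) * Real.exp (c * t) := by
        rw [mul_assoc, ← Real.exp_add]
        simp
    _ ≤ _ := mul_le_mul_of_nonneg_right h1 (Real.exp_pos _).le

theorem abs_eq_one_of_sq {σ : ℝ} (hσ : σ ^ 2 = 1) : |σ| = 1 := by
  rw [← sq_eq_sq₀ (abs_nonneg _) zero_le_one, sq_abs, hσ, one_pow]

/-- Values `m` such that `|Σ_φ| > m` is a trapping region, backwards in time, for `K₊` and `K₋`. -/
structure IsThreshold (lam gam m : ℝ) : Prop where
  pos : 0 < m
  lt_one : m < 1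
  slope_lt : |slope lam| < m
  gam_lt : gam < 2 * m ^ 2

/-- The bound m > |v| makes |Σ| nonincreasing in time where it exceeds m; m² > γ/2 makes Ω decay
backwards there. -/
theorem exists_isThreshold (h : Admissible lam gam) : ∃ m, IsThreshold lam gam m := by
  have h1 := h.abs_slope_lt_one
  have h2 : √(gam / 2) < 1 := by
    rw [Real.sqrt_lt' one_pos]
    linarith [h.gam_lt_two]
  obtain ⟨m, hm, hm1⟩ := exists_between (max_lt h1 h2)
  have h3 := (le_max_left _ _).trans_lt hm
  have h4 := (le_max_right _ _).trans_lt hm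
  have hm0 := (abs_nonneg _).trans_lt h3
  refine ⟨m, hm0, hm1, h3, ?_⟩
  rw [Real.sqrt_lt' hm0] at h4
  linarith

/-- The quadratic form `δΣ² - K δΩ²` of the difference of two states near `FL` decreases along
the flow. -/
theorem sub_sq_deriv_nonpos {K : ℝ} (hβ : 0 < 3 / 2 * (2 - gam)) (hgam : 0 < gam)
    (hK : K * (3 / 2 * (2 - gam) * gam) = 16)
    (h1 : -(3 * OmegaV p + 3 / 2 * (2 - gam) * p.2) + 3 * (p.1 + q.1) * q.1
      - 3 * slope lam * (p.1 + q.1) < -(3 / 2 * (2 - gam) / 2))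
    (h2 : |((3 - 3 / 2 * (2 - gam)) * q.1 - 3 * slope lam) - K * (6 * (p.1 + q.1) * p.2)| < 4)
    (h3 : gam < 6 * q.1 ^ 2 + 3 * gam * (p.2 + q.2 - 1)) :
    2 * (p.1 - q.1) * ((field lam gam p).1 - (field lam gam q).1)
      - K * (2 * (p.2 - q.2) * ((field lam gam p).2 - (field lam gam q).2)) ≤ 0 := by
  have hK0 : 0 < K := pos_of_mul_pos_left (by rw [hK]; norm_num) (by positivity)
  have key : 2 * (p.1 - q.1) * ((field lam gam p).1 - (field lam gam q).1)
      - K * (2 * (p.2 - q.2) * ((field lam gam p).2 - (field lam gam q).2)) =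
      2 * (-(3 * OmegaV p + 3 / 2 * (2 - gam) * p.2) + 3 * (p.1 + q.1) * q.1
        - 3 * slope lam * (p.1 + q.1)) * (p.1 - q.1) ^ 2
      + 2 * (((3 - 3 / 2 * (2 - gam)) * q.1 - 3 * slope lam) - K * (6 * (p.1 + q.1) * p.2))
        * ((p.1 - q.1) * (p.2 - q.2))
      - 2 * K * (6 * q.1 ^ 2 + 3 * gam * (p.2 + q.2 - 1)) * (p.2 - q.2) ^ 2 := by
    simp only [field_fst, field_snd, OmegaV]
    ring
  rw [key]
  generalize -(3 * OmegaV p + 3 / 2 * (2 - gam) * p.2) + 3 * (p.1 + q.1) * q.1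
    - 3 * slope lam * (p.1 + q.1) = A at *
  generalize ((3 - 3 / 2 * (2 - gam)) * q.1 - 3 * slope lam) - K * (6 * (p.1 + q.1) * p.2)
    = B at *
  generalize 6 * q.1 ^ 2 + 3 * gam * (p.2 + q.2 - 1) = C at *
  generalize 3 / 2 * (2 - gam) = β at *
  generalize p.1 - q.1 = X
  generalize p.2 - q.2 = Y
  have e1 : A * X ^ 2 ≤ -(β / 2) * X ^ 2 := mul_le_mul_of_nonneg_right h1.le (sq_nonneg X)
  have e2 : B * (X * Y) ≤ 4 * (|X| * |Y|) := by
    refine (le_abs_self _).trans ?_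
    rw [abs_mul, abs_mul]
    exact mul_le_mul_of_nonneg_right h2.le (by positivity)
  have e3 : K * gam * Y ^ 2 ≤ K * C * Y ^ 2 := by gcongr
  -- Kβγ = 16 is what completes this square; the 4 is the bound on the mixed coefficient B.
  have e4 : 0 ≤ β * (β * X ^ 2 + 2 * (K * gam) * Y ^ 2 - 8 * (|X| * |Y|)) := by
    have : β * (β * X ^ 2 + 2 * (K * gam) * Y ^ 2 - 8 * (|X| * |Y|))
        = (β * |X| - 4 * |Y|) ^ 2 + 16 * Y ^ 2 := by
      rw [← sq_abs X, ← sq_abs Y]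
      linear_combination 2 * |Y| ^ 2 * hK
    rw [this]
    positivity
  have e5 := nonneg_of_mul_nonneg_right e4 hβ
  linarith

namespace IsInteriorSolution

/-- Here σΣ' = -3Ω_V(σΣ - σv) - (3/2)(2 - γ)Ω·σΣ, and both terms are nonpositive once σΣ > m > |v|.
-/
theorem sign_mul_deriv_nonpos (h : Admissible lam gam) (hm : IsThreshold lam gam m)
    (hx : IsInteriorSolution lam gam x) {σ : ℝ} (hσ : σ ^ 2 = 1) (ht : m < σ * (x t).1) :
    σ * (-(3 * OmegaV (x t) + 3 / 2 * (2 - gam) * (x t).2) * (x t).1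
      + 3 * slope lam * OmegaV (x t)) ≤ 0 := by
  have hV := (hx.mem t).1
  have hy := (hx.mem t).2
  have hv : σ * slope lam < m := by
    refine (le_abs_self _).trans_lt ?_
    rw [abs_mul, abs_eq_one_of_sq hσ, one_mul]
    exact hm.slope_lt
  have h1 : 0 ≤ (2 - gam) * (x t).2 := mul_nonneg (by linarith [h.gam_lt_two]) hy.le
  have h2 : 0 ≤ OmegaV (x t) * (σ * (x t).1 - σ * slope lam) :=
    mul_nonneg hV.le (by linarith)
  have h3 : 0 ≤ (2 - gam) * (x t).2 * (σ * (x t).1) := mul_nonneg h1 (by linarith [hm.pos])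
  linarith

/-- The trapping regions of the kinaton points. -/
theorem tendsto_kinaton (h : Admissible lam gam) (hm : IsThreshold lam gam m)
    (hx : IsInteriorSolution lam gam x) {σ : ℝ} (hσ : σ ^ 2 = 1) (ht : m < σ * (x t).1) :
    Tendsto x atBot (𝓝 (σ, 0)) := by
  obtain ⟨-, hgt⟩ := antitoneOn_Iic_of_deriv_nonpos_of_gt
    (fun s ↦ (hx.hasDerivAt_fst s).const_mul σ)
    (fun s _ hs ↦ hx.sign_mul_deriv_nonpos h hm hσ hs) ht
  have hsnd : Tendsto (fun s ↦ (x s).2) atBot (𝓝 0) := by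
    refine tendsto_zero_atBot_of_le_deriv (c := 6 * m ^ 2 - 3 * gam) (t₀ := t)
      (by linarith [hm.gam_lt]) hx.hasDerivAt_snd (fun s ↦ (hx.mem s).2.le) fun s hs ↦ ?_
    refine mul_le_mul_of_nonneg_right ?_ (hx.mem s).2.le
    have h1 : m ^ 2 ≤ (σ * (x s).1) ^ 2 := pow_le_pow_left₀ hm.pos.le (hgt s hs).le 2
    rw [mul_pow, hσ, one_mul] at h1
    nlinarith [mul_pos h.gam_pos (hx.mem s).2]
  -- Σ² = 1 - (Ω_V + Ω) → 1, and the trapping region fixes the sign of Σ.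
  have hsq : Tendsto (fun s ↦ √((x s).1 ^ 2)) atBot (𝓝 1) := by
    have := (((hx.tendsto_OmegaV_atBot h).add hsnd).const_sub 1).sqrt
    rw [add_zero, sub_zero, Real.sqrt_one] at this
    refine this.congr fun s ↦ ?_
    unfold OmegaV
    congr 1
    ring
  have hfst : Tendsto (fun s ↦ (x s).1) atBot (𝓝 σ) := by
    have := hsq.const_mul σ
    rw [mul_one] at this
    refine this.congr' ?_
    filter_upwards [eventually_le_atBot t] with s hs
    rw [show (x s).1 ^ 2 = (σ * (x s).1) ^ 2 by rw [mul_pow, hσ, one_mul],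
      Real.sqrt_sq (hm.pos.trans (hgt s hs)).le, ← mul_assoc, ← pow_two, hσ, one_mul]
  exact hfst.prodMk_nhds hsnd

theorem tendsto_Kplus_of_lt (h : Admissible lam gam) (hm : IsThreshold lam gam m)
    (hx : IsInteriorSolution lam gam x) (ht : m < (x t).1) : Tendsto x atBot (𝓝 Kplus) :=
  hx.tendsto_kinaton h hm (σ := 1) (t := t) (by norm_num) (by linarith)

theorem tendsto_Kminus_of_lt (h : Admissible lam gam) (hm : IsThreshold lam gam m)
    (hx : IsInteriorSolution lam gam x) (ht : (x t).1 < -m) : Tendsto x atBot (𝓝 Kminus) :=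
  hx.tendsto_kinaton h hm (σ := -1) (t := t) (by norm_num) (by linarith)

/-- A solution that never enters the trapping regions of `K₊` and `K₋` has `Σ_φ → 0`. -/
theorem eventually_sign_mul_fst_le (h : Admissible lam gam) (hm : IsThreshold lam gam m)
    (hx : IsInteriorSolution lam gam x) (hle : ∀ t, |(x t).1| ≤ m) {σ ε : ℝ} (hσ : σ ^ 2 = 1)
    (hε : 0 < ε) : ∀ᶠ t in atBot, σ * (x t).1 ≤ ε := by
  have hm1 : m ^ 2 < 1 := by nlinarith [hm.pos, hm.lt_one]
  -- Once Ω_V < (1 - m²)/2, the bound |Σ| ≤ m gives Ω ≥ (1 - m²)/2, so Σ is damped at rate at least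
  -- k. Asking also Ω_V < kε/6 keeps the forcing 3vΩ_V below kε/2.
  set k := 3 / 2 * (2 - gam) * ((1 - m ^ 2) / 2) with hk
  have hk0 : 0 < k := by
    have := h.gam_lt_two
    have : 0 < 2 - gam := by linarith
    have : 0 < 1 - m ^ 2 := by linarith
    positivity
  have hV := hx.tendsto_OmegaV_atBot h
  have hev := (hV.eventually_lt_const (show 0 < (1 - m ^ 2) / 2 by linarith)).and
    (hV.eventually_lt_const (show 0 < k * ε / 6 by positivity))
  obtain ⟨T, hT⟩ := eventually_atBot.1 hev
  have hder : ∀ t ≤ T, ε < σ * (x t).1 →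
      σ * (-(3 * OmegaV (x t) + 3 / 2 * (2 - gam) * (x t).2) * (x t).1
        + 3 * slope lam * OmegaV (x t)) ≤ -(k * ε / 2) := by
    intro t ht hlt
    obtain ⟨h1, h2⟩ := hT t ht
    have hVt := (hx.mem t).1
    have hy : (1 - m ^ 2) / 2 ≤ (x t).2 := by
      have h3 : (x t).1 ^ 2 ≤ m ^ 2 := sq_le_sq' (abs_le.1 (hle t)).1 (abs_le.1 (hle t)).2
      unfold OmegaV at h1
      linarith
    have hQ : k ≤ 3 / 2 * (2 - gam) * (x t).2 :=
      mul_le_mul_of_nonneg_left hy (by linarith [h.gam_lt_two])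
    have hv : σ * slope lam ≤ 1 := by
      refine (le_abs_self _).trans ?_
      rw [abs_mul, abs_eq_one_of_sq hσ, one_mul]
      exact h.abs_slope_lt_one.le
    have h4 : k * ε ≤ (3 * OmegaV (x t) + 3 / 2 * (2 - gam) * (x t).2) * (σ * (x t).1) :=
      mul_le_mul (by linarith) hlt.le hε.le (by linarith)
    have h5 : OmegaV (x t) * (σ * slope lam) ≤ OmegaV (x t) * 1 :=
      mul_le_mul_of_nonneg_left hv hVt.le
    linarith
  filter_upwards [eventually_le_atBot T] with t ht
  by_contra! hlt
  obtain ⟨-, hgt⟩ := antitoneOn_Iic_of_deriv_nonpos_of_gt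
    (fun s ↦ (hx.hasDerivAt_fst s).const_mul σ)
    (fun s hs hs' ↦ (hder s (hs.trans ht) hs').trans (by
      have : 0 < k * ε := by positivity
      linarith)) hlt
  have hd : ∀ s, HasDerivAt (fun s ↦ σ * (x s).1 + k * ε / 2 * s)
      (σ * (-(3 * OmegaV (x s) + 3 / 2 * (2 - gam) * (x s).2) * (x s).1
        + 3 * slope lam * OmegaV (x s)) + k * ε / 2) s := fun s ↦ by
    simpa using ((hx.hasDerivAt_fst s).const_mul σ).fun_add
      ((hasDerivAt_id s).const_mul (k * ε / 2))
  have hanti : AntitoneOn (fun s ↦ σ * (x s).1 + k * ε / 2 * s) (Iic t) := by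
    refine antitoneOn_of_hasDerivWithinAt_nonpos (convex_Iic t)
      (fun s _ ↦ (hd s).continuousAt.continuousWithinAt)
      (fun s _ ↦ (hd s).hasDerivWithinAt) fun s hs ↦ ?_
    have hs' : s ≤ t := mem_Iic.1 (interior_subset hs)
    linarith [hder s (hs'.trans ht) (hgt s hs')]
  have hkε : 0 < k * ε / 2 := by positivity
  -- Going back by this time raises σΣ by at least 1, from above ε > 0, which contradicts |Σ| ≤ 1.
  have hs : t - 1 / (k * ε / 2) ≤ t := by
    have : 0 < 1 / (k * ε / 2) := by positivity
    linarith
  have h1 := hanti (mem_Iic.2 hs) (mem_Iic.2 le_rfl) hs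
  simp only at h1
  rw [mul_sub, mul_one_div_cancel hkε.ne'] at h1
  have h2 : σ * (x (t - 1 / (k * ε / 2))).1 ≤ 1 := by
    refine (le_abs_self _).trans ?_
    rw [abs_mul, abs_eq_one_of_sq hσ, one_mul]
    exact abs_fst_le_one (hx.mem_closed _)
  linarith

/-- Every interior solution originates from `K₋`, `FL` or `K₊`. -/
theorem tendsto_atBot_trichotomy (h : Admissible lam gam) (hx : IsInteriorSolution lam gam x) :
    Tendsto x atBot (𝓝 Kminus) ∨ Tendsto x atBot (𝓝 FL) ∨ Tendsto x atBot (𝓝 Kplus) := by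
  obtain ⟨m, hm⟩ := exists_isThreshold h
  by_cases hle : ∀ t, |(x t).1| ≤ m
  · right; left
    have hfst : Tendsto (fun t ↦ (x t).1) atBot (𝓝 0) := by
      rw [Metric.tendsto_nhds]
      intro ε hε
      filter_upwards [hx.eventually_sign_mul_fst_le h hm hle (σ := 1) (by norm_num) (half_pos hε),
        hx.eventually_sign_mul_fst_le h hm hle (σ := -1) (by norm_num) (half_pos hε)] with t h1 h2
      rw [dist_zero_right, Real.norm_eq_abs, abs_lt]
      constructor <;> linarith
    have hsnd : Tendsto (fun t ↦ (x t).2) atBot (𝓝 1) := by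
      have := ((hfst.pow 2).const_sub 1).sub (hx.tendsto_OmegaV_atBot h)
      norm_num at this
      refine this.congr fun t ↦ ?_
      unfold OmegaV
      ring
    exact hfst.prodMk_nhds hsnd
  · push Not at hle
    obtain ⟨t, ht⟩ := hle
    rcases lt_abs.1 ht with h1 | h1
    · exact Or.inr (Or.inr (hx.tendsto_Kplus_of_lt h hm h1))
    · exact Or.inl (hx.tendsto_Kminus_of_lt h hm (by linarith))

/-- Two interior solutions that originate from `FL` have the same orbit. -/
theorem exists_eq_of_tendsto_FL (h : Admissible lam gam) (hx : IsInteriorSolution lam gam x)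
    (hy : IsInteriorSolution lam gam y) (hxF : Tendsto x atBot (𝓝 FL))
    (hyF : Tendsto y atBot (𝓝 FL)) : ∃ t s, x t = y s := by
  have hgam := h.gam_pos
  set β := 3 / 2 * (2 - gam) with hβ
  have hβ0 : 0 < β := by linarith [h.gam_lt_two]
  set K := 16 / (β * gam) with hK
  have hK0 : 0 < K := by positivity
  have hKe : K * (β * gam) = 16 := div_mul_cancel₀ _ (by positivity)
  have hZF : ContinuousAt (lyapunov lam) FL := by
    refine continuous_OmegaV.continuousAt.div (by fun_prop) ?_
    simp [FL]
  have hZ0 : lyapunov lam FL = 0 := by simp [lyapunov, OmegaV, FL]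
  have hFV : OmegaV FL = 0 := by simp [OmegaV, FL]
  have hv := abs_lt.1 h.abs_slope_lt_one
  have hcV := continuous_OmegaV
  have hZc : ContinuousAt (fun r : State × State ↦ lyapunov lam r.1) (FL, FL) :=
    ContinuousAt.comp (f := Prod.fst) (g := lyapunov lam) hZF continuousAt_fst
  -- At (FL, FL) the four left-to-right comparisons read -β < -β/2, |3v| < 4, γ < 3γ and 0 < 1, so
  -- all persist nearby.
  have hev : ∀ᶠ r : State × State in 𝓝 FL ×ˢ 𝓝 FL,
      -(3 * OmegaV r.1 + β * r.1.2) + 3 * (r.1.1 + r.2.1) * r.2.1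
          - 3 * slope lam * (r.1.1 + r.2.1) < -(β / 2) ∧
      |((3 - β) * r.2.1 - 3 * slope lam) - K * (6 * (r.1.1 + r.2.1) * r.1.2)| < 4 ∧
      gam < 6 * r.2.1 ^ 2 + 3 * gam * (r.1.2 + r.2.2 - 1) ∧
      K * (-(r.1.1 + r.2.1) + lyapunov lam r.1 *
        (slope lam * (2 - slope lam * (r.1.1 + r.2.1)))) ^ 2 < 1 := by
    rw [← nhds_prod_eq]
    refine ContinuousAt.eventually_lt (by fun_prop) (by fun_prop) ?_ |>.and
      (ContinuousAt.eventually_lt (by fun_prop) (by fun_prop) ?_ |>.and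
      (ContinuousAt.eventually_lt (by fun_prop) (by fun_prop) ?_ |>.and
      (ContinuousAt.eventually_lt (by fun_prop) (by fun_prop) ?_)))
    · simp only [hFV]
      simp only [FL]
      linarith
    · simp only [FL]
      rw [abs_lt]
      constructor <;> linarith
    · simp only [FL]
      linarith
    · simp only [hZ0]
      simp [FL]
  obtain ⟨pa, ha, pb, hb, hab⟩ := eventually_prod_iff.1 hev
  obtain ⟨T, hT⟩ := eventually_atBot.1 ((hxF.eventually ha).and (hyF.eventually hb))
  have hxr := hx.range_lyapunov h
  have hyr := hy.range_lyapunov h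
  -- A level attained by both solutions no later than T, so that both stay near FL before reaching
  -- it.
  have hz : min (lyapunov lam (x T)) (lyapunov lam (y T)) ∈
      Ioo 0 (1 / (1 - slope lam ^ 2)) := by
    rcases min_choice (lyapunov lam (x T)) (lyapunov lam (y T)) with h1 | h1 <;> rw [h1]
    · exact hxr ▸ mem_range_self (f := fun t ↦ lyapunov lam (x t)) T
    · exact hyr ▸ mem_range_self (f := fun t ↦ lyapunov lam (y t)) T
  obtain ⟨t₀, ht₀⟩ := hxr.ge hz
  obtain ⟨s₀, hs₀⟩ := hyr.ge hz
  simp only at ht₀ hs₀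
  have ht₀T : t₀ ≤ T := (hx.strictMono_lyapunov h).le_iff_le.1 (ht₀.trans_le (min_le_left _ _))
  have hs₀T : s₀ ≤ T := (hy.strictMono_lyapunov h).le_iff_le.1 (hs₀.trans_le (min_le_right _ _))
  refine ⟨t₀, s₀, ?_⟩
  have hX := hx.comp_add t₀
  have hY := hy.comp_add s₀
  have hnear : ∀ r ≤ 0, pa (x (r + t₀)) ∧ pb (y (r + s₀)) := fun r hr ↦
    ⟨(hT _ (by linarith)).1, (hT _ (by linarith)).2⟩
  have hd : ∀ r, HasDerivAt (fun r ↦ ((x (r + t₀)).1 - (y (r + s₀)).1) ^ 2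
      - K * ((x (r + t₀)).2 - (y (r + s₀)).2) ^ 2) _ r := fun r ↦
    (((ScalarFluid.hasDerivAt_fst (hX.hasDerivAt r)).fun_sub
      (ScalarFluid.hasDerivAt_fst (hY.hasDerivAt r))).fun_pow 2).fun_sub
      ((((ScalarFluid.hasDerivAt_snd (hX.hasDerivAt r)).fun_sub
      (ScalarFluid.hasDerivAt_snd (hY.hasDerivAt r))).fun_pow 2).const_mul K)
  have hanti : AntitoneOn (fun r ↦ ((x (r + t₀)).1 - (y (r + s₀)).1) ^ 2
      - K * ((x (r + t₀)).2 - (y (r + s₀)).2) ^ 2) (Iic 0) := by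
    refine antitoneOn_of_hasDerivWithinAt_nonpos (convex_Iic 0)
      (fun s _ ↦ (hd s).continuousAt.continuousWithinAt)
      (fun s _ ↦ (hd s).hasDerivWithinAt) fun r hr ↦ ?_
    have hr' : r ≤ 0 := mem_Iic.1 (interior_subset hr)
    obtain ⟨h1, h2, h3, -⟩ := hab (hnear r hr').1 (hnear r hr').2
    simp only at h1 h2 h3
    simpa using sub_sq_deriv_nonpos hβ0 hgam hKe h1 h2 h3
  have hlim : Tendsto (fun r ↦ ((x (r + t₀)).1 - (y (r + s₀)).1) ^ 2
      - K * ((x (r + t₀)).2 - (y (r + s₀)).2) ^ 2) atBot (𝓝 0) := by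
    have hx' := hxF.comp (tendsto_atBot_add_const_right _ t₀ tendsto_id)
    have hy' := hyF.comp (tendsto_atBot_add_const_right _ s₀ tendsto_id)
    have := ((hx'.fst_nhds.sub hy'.fst_nhds).pow 2).sub
      (((hx'.snd_nhds.sub hy'.snd_nhds).pow 2).const_mul K)
    simpa using this
  have hle : ((x t₀).1 - (y s₀).1) ^ 2 - K * ((x t₀).2 - (y s₀).2) ^ 2 ≤ 0 := by
    refine ge_of_tendsto hlim ?_
    filter_upwards [eventually_le_atBot 0] with r hr
    simpa using hanti hr (mem_Iic.2 le_rfl) hr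
  have h4 := (hab (hT t₀ ht₀T).1 (hT s₀ hs₀T).2).2.2.2
  have hZeq : lyapunov lam (x t₀) = lyapunov lam (y s₀) := ht₀.trans hs₀.symm
  refine eq_of_lyapunov_eq h (hx.mem_closed _) (hy.mem_closed _) hZeq ?_
  -- On one level δΩ = L·δΣ, and K L² < 1 near FL; with δΣ² ≤ K δΩ² this forces δΣ = 0.
  have hδ : (x t₀).2 - (y s₀).2 = (-((x t₀).1 + (y s₀).1) + lyapunov lam (x t₀) *
      (slope lam * (2 - slope lam * ((x t₀).1 + (y s₀).1)))) * ((x t₀).1 - (y s₀).1) := by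
    rw [snd_eq_of_lyapunov h (hx.mem_closed t₀), snd_eq_of_lyapunov h (hy.mem_closed s₀), ← hZeq]
    ring
  rw [hδ, mul_pow, ← mul_assoc] at hle
  by_contra hne
  have : 0 < ((x t₀).1 - (y s₀).1) ^ 2 := by
    have := sub_ne_zero.2 hne
    positivity
  simp only at h4
  nlinarith

end IsInteriorSolution

/-! ### Order of the orbits on level sets, and the global section. -/

variable {z a b s t' s' u r : ℝ}

namespace IsInteriorSolution

/-- Solutions with a common orbit agree at points of the same level of the Lyapunov function. -/
theorem eq_of_lyapunov_eq_of_eq (h : Admissible lam gam) (hx : IsInteriorSolution lam gam x)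
    (hy : IsInteriorSolution lam gam y) (heq : x t = y s)
    (hZ : lyapunov lam (x t') = lyapunov lam (y s')) : x t' = y s' := by
  have hxy := congrFun (hx.eq_shift_of_eq hy heq) t'
  rw [hxy] at hZ ⊢
  rw [(hy.strictMono_lyapunov h).injective hZ]

/-- On the level sets of the Lyapunov function, the order of two orbits by `Σ_φ` does not depend
on the level. -/
theorem fst_lt_of_fst_lt (h : Admissible lam gam) (hx : IsInteriorSolution lam gam x)
    (hy : IsInteriorSolution lam gam y) (hZ : lyapunov lam (x t) = lyapunov lam (y s))
    (hlt : (x t).1 < (y s).1) (hZ' : lyapunov lam (x t') = lyapunov lam (y s')) :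
    (x t').1 < (y s').1 := by
  have hxs := hx.strictMono_lyapunov h
  have hys := hy.strictMono_lyapunov h
  have hr : range (fun t ↦ lyapunov lam (x t)) = range (fun t ↦ lyapunov lam (y t)) :=
    (hx.range_lyapunov h).trans (hy.range_lyapunov h).symm
  -- τ matches times of equal level. Being monotone and onto, it is continuous, so a change of order
  -- would produce a common point by the intermediate value theorem.
  choose τ hτ using fun r ↦ hr.le (mem_range_self r)
  have hτu : ∀ r s, lyapunov lam (x r) = lyapunov lam (y s) → τ r = s := fun r s hrs ↦
    hys.injective ((hτ r).trans hrs)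
  have hmono : Monotone τ := fun r r' hrr ↦ hys.le_iff_le.1 (by
    simpa only [hτ] using hxs.monotone hrr)
  have hsurj : Function.Surjective τ := by
    intro s
    obtain ⟨r, hrs⟩ := hr.ge (mem_range_self s)
    exact ⟨r, hτu r s hrs⟩
  have hd : Continuous fun r ↦ (x r).1 - (y (τ r)).1 :=
    (continuous_fst.comp hx.continuous).sub
      (continuous_fst.comp (hy.continuous.comp (hmono.continuous_of_surjective hsurj)))
  by_contra! hge
  obtain ⟨r, hr0⟩ : 0 ∈ range fun r ↦ (x r).1 - (y (τ r)).1 :=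
    mem_range_of_exists_le_of_exists_ge hd
      ⟨t, by rw [hτu t s hZ]; linarith⟩ ⟨t', by rw [hτu t' s' hZ']; linarith⟩
  have heq : x r = y (τ r) := eq_of_lyapunov_eq h (hx.mem_closed _) (hy.mem_closed _)
    (hτ r).symm (sub_eq_zero.1 hr0)
  rw [hx.eq_of_lyapunov_eq_of_eq h hy heq hZ] at hlt
  exact lt_irrefl _ hlt

end IsInteriorSolution

/-- The level set `lyapunov = z` as a graph over `Σ_φ`. -/
noncomputable def levelCurve (lam z u : ℝ) : State :=
  (u, 1 - u ^ 2 - z * (1 - slope lam * u) ^ 2)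

theorem continuous_levelCurve (lam z : ℝ) : Continuous (levelCurve lam z) := by
  unfold levelCurve
  fun_prop

theorem levelCurve_lyapunov (h : Admissible lam gam) (hp : p ∈ closedStates) :
    levelCurve lam (lyapunov lam p) p.1 = p := by
  ext
  · rfl
  · exact (snd_eq_of_lyapunov h hp).symm

theorem lyapunov_levelCurve (h : Admissible lam gam)
    (hu : levelCurve lam z u ∈ closedStates) : lyapunov lam (levelCurve lam z u) = z := by
  have h1 : 1 - slope lam * u ≠ 0 := (h.one_sub_pos hu).ne'
  simp only [lyapunov, levelCurve, OmegaV]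
  rw [div_eq_iff (pow_ne_zero 2 h1)]
  ring

/-- The global section `lyapunov = 1 / 2` of the flow. -/
noncomputable def sectionCurve (lam : ℝ) : ℝ → State := levelCurve lam (1 / 2)

/-- The parameters of the interior part of the section. -/
def sectionDomain (lam : ℝ) : Set ℝ := {u | sectionCurve lam u ∈ interiorStates}

theorem lyapunov_sectionCurve (h : Admissible lam gam) (hu : u ∈ sectionDomain lam) :
    lyapunov lam (sectionCurve lam u) = 1 / 2 :=
  lyapunov_levelCurve h (interiorStates_subset hu)

/-- On the section Ω = 1/2 + vu - Au² with A = 1 + v²/2, positive exactly between its two roots; Ω >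
0 already implies |u| < 1 and hence Ω_V > 0. -/
theorem sectionDomain_eq_Ioo (h : Admissible lam gam) : ∃ a b, sectionDomain lam = Ioo a b := by
  have hA : 0 < 1 + slope lam ^ 2 / 2 := by positivity
  generalize hAe : 1 + slope lam ^ 2 / 2 = A at hA
  set w := √(slope lam ^ 2 + 2 * A) with hw
  have hw2 : w ^ 2 = slope lam ^ 2 + 2 * A := Real.sq_sqrt (by positivity)
  have hw0 : 0 < w := Real.sqrt_pos.2 (by positivity)
  refine ⟨(slope lam - w) / (2 * A), (slope lam + w) / (2 * A), ?_⟩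
  ext u
  have key : (1 - u ^ 2 - 1 / 2 * (1 - slope lam * u) ^ 2) * (4 * A) =
      (u * (2 * A) - (slope lam - w)) * ((slope lam + w) - u * (2 * A)) := by
    rw [← hAe] at *
    linear_combination -hw2
  rw [mem_Ioo, div_lt_iff₀ (by positivity), lt_div_iff₀ (by positivity)]
  constructor
  · intro hu
    have h1 : 0 < (1 - u ^ 2 - 1 / 2 * (1 - slope lam * u) ^ 2) * (4 * A) :=
      mul_pos hu.2 (by positivity)
    rw [key] at h1
    rcases mul_pos_iff.1 h1 with h2 | h2
    · exact ⟨by linarith, by linarith⟩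
    · linarith
  · rintro ⟨h1, h2⟩
    have h3 : 0 < (1 - u ^ 2 - 1 / 2 * (1 - slope lam * u) ^ 2) * (4 * A) := by
      rw [key]
      exact mul_pos (by linarith) (by linarith)
    have h4 : 0 < 1 - u ^ 2 - 1 / 2 * (1 - slope lam * u) ^ 2 :=
      pos_of_mul_pos_left h3 (by positivity)
    refine ⟨?_, h4⟩
    have h5 : |u| ≤ 1 := by
      rw [← sq_le_one_iff_abs_le_one]
      nlinarith [sq_nonneg (1 - slope lam * u)]
    have h6 : |slope lam * u| < 1 := by
      rw [abs_mul]
      exact mul_lt_one_of_nonneg_of_lt_one_left (abs_nonneg _) h.abs_slope_lt_one h5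
    have h7 : 0 < 1 - slope lam * u := by linarith [(abs_lt.1 h6).2]
    have h8 : OmegaV (sectionCurve lam u) = 1 / 2 * (1 - slope lam * u) ^ 2 := by
      simp only [OmegaV, sectionCurve, levelCurve]
      ring
    rw [h8]
    positivity

theorem IsInteriorSolution.exists_sectionCurve (h : Admissible lam gam)
    (hx : IsInteriorSolution lam gam x) :
    ∃ t, lyapunov lam (x t) = 1 / 2 ∧ x t = sectionCurve lam (x t).1 ∧
      (x t).1 ∈ sectionDomain lam := by
  -- The maximum 1/(1 - v²) is at least 1, so the level 1/2 serves all admissible parameters.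
  have h1 : (1 / 2 : ℝ) ∈ Ioo 0 (1 / (1 - slope lam ^ 2)) := by
    have h2 := h.slope_sq_lt_one
    refine ⟨by norm_num, (div_lt_div_iff₀ two_pos (by linarith)).2 ?_⟩
    nlinarith [sq_nonneg (slope lam)]
  obtain ⟨t, ht⟩ := (hx.range_lyapunov h).ge h1
  simp only at ht
  have h2 : x t = sectionCurve lam (x t).1 := by
    rw [sectionCurve, ← ht, levelCurve_lyapunov h (hx.mem_closed t)]
  refine ⟨t, ht, h2, ?_⟩
  rw [sectionDomain, mem_ofPred_eq, ← h2]
  exact hx.mem t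

/-! ### Sources of the orbits in terms of the section. -/

/-- The parameters of the orbits that tend to `κ` backwards in time. -/
def sourceSet (lam gam : ℝ) (κ : State) : Set ℝ :=
  {u | ∃ x, IsInteriorSolution lam gam x ∧ x 0 = sectionCurve lam u ∧ Tendsto x atBot (𝓝 κ)}

theorem sourceSet_subset (κ : State) : sourceSet lam gam κ ⊆ sectionDomain lam := by
  rintro u ⟨x, hx, hxu, -⟩
  rw [sectionDomain, mem_ofPred_eq, ← hxu]
  exact hx.mem 0

theorem tendsto_comp_add_atBot {κ : State} (hx : Tendsto x atBot (𝓝 κ)) (s : ℝ) :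
    Tendsto (fun t ↦ x (t + s)) atBot (𝓝 κ) :=
  hx.comp (tendsto_atBot_add_const_right _ s tendsto_id)

theorem IsInteriorSolution.mem_sourceSet {κ : State} (hx : IsInteriorSolution lam gam x)
    (ht : x t = sectionCurve lam u) (hκ : Tendsto x atBot (𝓝 κ)) : u ∈ sourceSet lam gam κ :=
  ⟨fun s ↦ x (s + t), hx.comp_add t, by simpa using ht, tendsto_comp_add_atBot hκ t⟩

theorem IsInteriorSolution.tendsto_iff_mem_sourceSet {κ : State}
    (hx : IsInteriorSolution lam gam x) (ht : x t = sectionCurve lam u) :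
    Tendsto x atBot (𝓝 κ) ↔ u ∈ sourceSet lam gam κ := by
  refine ⟨hx.mem_sourceSet ht, fun ⟨y, hy, hyu, hyκ⟩ ↦ ?_⟩
  rw [hx.eq_shift_of_eq hy (ht.trans hyu.symm)]
  exact tendsto_comp_add_atBot hyκ _

theorem mem_sourceSet_trichotomy (h : Admissible lam gam) (hu : u ∈ sectionDomain lam) :
    u ∈ sourceSet lam gam Kminus ∨ u ∈ sourceSet lam gam FL ∨ u ∈ sourceSet lam gam Kplus := by
  obtain ⟨x, hx, hx0⟩ := exists_isInteriorSolution h hu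
  simp only [← hx.tendsto_iff_mem_sourceSet hx0]
  exact hx.tendsto_atBot_trichotomy h

theorem disjoint_sourceSet {κ κ' : State} (hne : κ ≠ κ') :
    Disjoint (sourceSet lam gam κ) (sourceSet lam gam κ') := by
  rw [Set.disjoint_left]
  rintro u ⟨x, hx, hxu, hxκ⟩ hu
  exact hne (tendsto_nhds_unique hxκ ((hx.tendsto_iff_mem_sourceSet hxu).2 hu))

theorem subsingleton_sourceSet_FL (h : Admissible lam gam) :
    (sourceSet lam gam FL).Subsingleton := by
  intro u hu r hr
  have hu' := sourceSet_subset _ hu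
  have hr' := sourceSet_subset _ hr
  obtain ⟨x, hx, hxu, hxF⟩ := hu
  obtain ⟨y, hy, hyr, hyF⟩ := hr
  obtain ⟨t, s, hts⟩ := hx.exists_eq_of_tendsto_FL h hy hxF hyF
  have hxy := hx.eq_of_lyapunov_eq_of_eq h hy hts (t' := 0) (s' := 0) (by
    rw [hxu, hyr, lyapunov_sectionCurve h hu', lyapunov_sectionCurve h hr'])
  rw [hxu, hyr] at hxy
  exact congrArg Prod.fst hxy

theorem exists_lt_fst_of_tendsto_Kplus (hm : IsThreshold lam gam m)
    (hx : Tendsto x atBot (𝓝 Kplus)) : ∃ t, m < (x t).1 :=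
  (hx.fst_nhds.eventually_const_lt (show m < Kplus.1 from hm.lt_one)).exists

theorem exists_fst_lt_of_tendsto_Kminus (hm : IsThreshold lam gam m)
    (hx : Tendsto x atBot (𝓝 Kminus)) : ∃ t, (x t).1 < -m :=
  (hx.fst_nhds.eventually_lt_const (show Kminus.1 < -m from neg_lt_neg hm.lt_one)).exists

theorem IsInteriorSolution.exists_lyapunov_eq (h : Admissible lam gam)
    (hx : IsInteriorSolution lam gam x) (hp : IsInteriorSolution lam gam y) (t : ℝ) :
    ∃ s, lyapunov lam (x s) = lyapunov lam (y t) :=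
  ((hp.range_lyapunov h).trans (hx.range_lyapunov h).symm).le (mem_range_self t)

/-- The orbit through r stays to the left on every level, so it enters Σ < -m together with the
orbit through u. -/
theorem sourceSet_Kminus_downward (h : Admissible lam gam) (hu : u ∈ sourceSet lam gam Kminus)
    (hr : r ∈ sectionDomain lam) (hur : r < u) : r ∈ sourceSet lam gam Kminus := by
  obtain ⟨m, hm⟩ := exists_isThreshold h
  have hu' := sourceSet_subset _ hu
  obtain ⟨x, hx, hxu, hxK⟩ := hu
  obtain ⟨y, hy, hyr⟩ := exists_isInteriorSolution h hr
  obtain ⟨t, ht⟩ := exists_fst_lt_of_tendsto_Kminus hm hxK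
  obtain ⟨s, hs⟩ := hy.exists_lyapunov_eq h hx t
  have hlt := hy.fst_lt_of_fst_lt h hx (t := 0) (s := 0)
    (by rw [hxu, hyr, lyapunov_sectionCurve h hu', lyapunov_sectionCurve h hr])
    (by rw [hxu, hyr]; exact hur) hs
  exact hy.mem_sourceSet hyr (hy.tendsto_Kminus_of_lt h hm (hlt.trans ht))

/-- States on the same level close to a state of an interior solution are again interior. -/
theorem IsInteriorSolution.eventually_levelCurve_mem (h : Admissible lam gam)
    (hx : IsInteriorSolution lam gam x) (t : ℝ) :
    ∀ᶠ v in 𝓝 (x t).1, levelCurve lam (lyapunov lam (x t)) v ∈ interiorStates := by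
  refine (continuous_levelCurve lam _).continuousAt.eventually
    (isOpen_interiorStates.mem_nhds ?_)
  rw [levelCurve_lyapunov h (hx.mem_closed t)]
  exact hx.mem t

/-- Having Σ > m is an open condition: a small step to the left within the level stays in the
trapping region, and order preservation carries it to a smaller parameter on the section. -/
theorem sourceSet_Kplus_no_min (h : Admissible lam gam) (hu : u ∈ sourceSet lam gam Kplus) :
    ∃ r ∈ sourceSet lam gam Kplus, r < u := by
  obtain ⟨m, hm⟩ := exists_isThreshold h
  have hu' := sourceSet_subset _ hu
  obtain ⟨x, hx, hxu, hxK⟩ := hu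
  obtain ⟨t, ht⟩ := exists_lt_fst_of_tendsto_Kplus hm hxK
  obtain ⟨v, hv, hmv, hvx⟩ := ((hx.eventually_levelCurve_mem h t).filter_mono
    nhdsWithin_le_nhds |>.and (Ioo_mem_nhdsLT ht)).exists
  obtain ⟨y, hy, hy0⟩ := exists_isInteriorSolution h hv
  obtain ⟨s, hs, hsc, -⟩ := hy.exists_sectionCurve h
  refine ⟨(y s).1, hy.mem_sourceSet hsc (hy.tendsto_Kplus_of_lt h hm (t := 0) ?_), ?_⟩
  · rw [hy0]
    exact hmv
  · have := hy.fst_lt_of_fst_lt h hx (t := 0) (s := t) (t' := s) (s' := 0)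
      (by rw [hy0, lyapunov_levelCurve h (interiorStates_subset hv)])
      (by rw [hy0]; exact hvx) (by rw [hs, hxu, lyapunov_sectionCurve h hu'])
    rwa [hxu] at this

theorem sourceSet_Kminus_no_max (h : Admissible lam gam) (hu : u ∈ sourceSet lam gam Kminus) :
    ∃ r ∈ sourceSet lam gam Kminus, u < r := by
  obtain ⟨m, hm⟩ := exists_isThreshold h
  have hu' := sourceSet_subset _ hu
  obtain ⟨x, hx, hxu, hxK⟩ := hu
  obtain ⟨t, ht⟩ := exists_fst_lt_of_tendsto_Kminus hm hxK
  obtain ⟨v, hv, hmv, hvx⟩ := ((hx.eventually_levelCurve_mem h t).filter_mono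
    nhdsWithin_le_nhds |>.and (Ioo_mem_nhdsGT ht)).exists
  obtain ⟨y, hy, hy0⟩ := exists_isInteriorSolution h hv
  obtain ⟨s, hs, hsc, -⟩ := hy.exists_sectionCurve h
  refine ⟨(y s).1, hy.mem_sourceSet hsc (hy.tendsto_Kminus_of_lt h hm (t := 0) ?_), ?_⟩
  · rw [hy0]
    exact hvx
  · have := hx.fst_lt_of_fst_lt h hy (t := t) (s := 0) (t' := 0) (s' := s)
      (by rw [hy0, lyapunov_levelCurve h (interiorStates_subset hv)])
      (by rw [hy0]; exact hmv) (by rw [hs, hxu, lyapunov_sectionCurve h hu'])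
    rwa [hxu] at this

theorem exists_isInteriorSolution_fst_eq (h : Admissible lam gam) (hu : u ^ 2 < 1) :
    ∃ x, IsInteriorSolution lam gam x ∧ (x 0).1 = u := by
  have hp : ((u, (1 - u ^ 2) / 2) : State) ∈ interiorStates := by
    refine ⟨?_, ?_⟩ <;> simp only [OmegaV] <;> linarith
  obtain ⟨x, hx, hx0⟩ := exists_isInteriorSolution h hp
  exact ⟨x, hx, by rw [hx0]⟩

theorem sourceSet_Kplus_nonempty (h : Admissible lam gam) : (sourceSet lam gam Kplus).Nonempty := by
  obtain ⟨m, hm⟩ := exists_isThreshold h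
  obtain ⟨u, hmu, hu1⟩ := exists_between hm.lt_one
  obtain ⟨x, hx, hx0⟩ := exists_isInteriorSolution_fst_eq h (u := u) (by nlinarith [hm.pos])
  obtain ⟨s, -, hsc, -⟩ := hx.exists_sectionCurve h
  exact ⟨_, hx.mem_sourceSet hsc (hx.tendsto_Kplus_of_lt h hm (t := 0) (by rwa [hx0]))⟩

theorem sourceSet_Kminus_nonempty (h : Admissible lam gam) :
    (sourceSet lam gam Kminus).Nonempty := by
  obtain ⟨m, hm⟩ := exists_isThreshold h
  obtain ⟨u, hmu, hu1⟩ := exists_between hm.lt_one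
  obtain ⟨x, hx, hx0⟩ := exists_isInteriorSolution_fst_eq h (u := -u) (by nlinarith [hm.pos])
  obtain ⟨s, -, hsc, -⟩ := hx.exists_sectionCurve h
  exact ⟨_, hx.mem_sourceSet hsc
    (hx.tendsto_Kminus_of_lt h hm (t := 0) (by rw [hx0]; linarith))⟩

theorem Kminus_ne_Kplus : Kminus ≠ Kplus := by
  intro h
  have := congrArg Prod.fst h
  norm_num [Kminus, Kplus] at this

/-- The section is an open interval, split by the orbit from `FL` into the orbits from `K₋` and
the orbits from `K₊`. -/
theorem exists_sourceSet_eq (h : Admissible lam gam) : ∃ a c b, a < c ∧ c < b ∧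
    sectionDomain lam = Ioo a b ∧ sourceSet lam gam Kminus = Ioo a c ∧
    sourceSet lam gam FL = {c} ∧ sourceSet lam gam Kplus = Ioo c b := by
  obtain ⟨a, b, hab⟩ := sectionDomain_eq_Ioo h
  have hdis := Set.disjoint_left.1 (disjoint_sourceSet (lam := lam) (gam := gam) Kminus_ne_Kplus)
  have hlt : ∀ u ∈ sourceSet lam gam Kminus, ∀ r ∈ sourceSet lam gam Kplus, u < r := by
    intro u hu r hr
    by_contra! hle
    rcases hle.lt_or_eq with hlt | rfl
    · exact hdis (sourceSet_Kminus_downward h hu (sourceSet_subset _ hr) hlt) hr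
    · exact hdis hu hr
  obtain ⟨u₀, hu₀⟩ := sourceSet_Kminus_nonempty h
  obtain ⟨r₀, hr₀⟩ := sourceSet_Kplus_nonempty h
  -- By the absence of a maximum and a minimum, c belongs to neither kinaton set, so the trichotomy
  -- puts it on an orbit from FL.
  set c := sSup (sourceSet lam gam Kminus) with hc
  have hbdd : BddAbove (sourceSet lam gam Kminus) := ⟨r₀, fun u hu ↦ (hlt u hu r₀ hr₀).le⟩
  have hltc : ∀ u ∈ sourceSet lam gam Kminus, u < c := by
    intro u hu
    obtain ⟨r, hr, hur⟩ := sourceSet_Kminus_no_max h hu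
    exact hur.trans_le (le_csSup hbdd hr)
  have hclt : ∀ r ∈ sourceSet lam gam Kplus, c < r := by
    intro r hr
    obtain ⟨u, hu, hur⟩ := sourceSet_Kplus_no_min h hr
    exact (csSup_le ⟨u₀, hu₀⟩ fun v hv ↦ (hlt v hv u hu).le).trans_lt hur
  have hu₀D := sourceSet_subset _ hu₀
  have hr₀D := sourceSet_subset _ hr₀
  rw [hab] at hu₀D hr₀D
  have hac : a < c := hu₀D.1.trans (hltc _ hu₀)
  have hcb : c < b := (hclt _ hr₀).trans hr₀D.2
  have hcD : c ∈ sectionDomain lam := hab ▸ ⟨hac, hcb⟩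
  have hcF : c ∈ sourceSet lam gam FL := by
    rcases mem_sourceSet_trichotomy h hcD with h1 | h1 | h1
    · exact absurd (hltc _ h1) (lt_irrefl _)
    · exact h1
    · exact absurd (hclt _ h1) (lt_irrefl _)
  have hFc : ∀ u ∈ sourceSet lam gam FL, u = c := fun u hu ↦ subsingleton_sourceSet_FL h hu hcF
  refine ⟨a, c, b, hac, hcb, hab, ?_, ?_, ?_⟩
  · refine Subset.antisymm (fun u hu ↦ ⟨(hab.le (sourceSet_subset _ hu)).1, hltc u hu⟩) ?_
    rintro u ⟨hau, huc⟩
    rcases mem_sourceSet_trichotomy h (hab.ge ⟨hau, huc.trans hcb⟩) with h1 | h1 | h1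
    · exact h1
    · exact absurd (hFc u h1) huc.ne
    · exact absurd (hclt u h1) huc.not_gt
  · exact Subset.antisymm hFc (singleton_subset_iff.2 hcF)
  · refine Subset.antisymm (fun u hu ↦ ⟨hclt u hu, (hab.le (sourceSet_subset _ hu)).2⟩) ?_
    rintro u ⟨hcu, hub⟩
    rcases mem_sourceSet_trichotomy h (hab.ge ⟨hac.trans hcu, hub⟩) with h1 | h1 | h1
    · exact absurd (hltc u h1) hcu.not_gt
    · exact absurd (hFc u h1) hcu.ne'
    · exact h1

/-! ### From solutions to orbits, and the theorem. -/

theorem isInteriorOrbit_iff {O : Set State} :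
    IsInteriorOrbit lam gam O ↔ ∃ x, IsInteriorSolution lam gam x ∧ range x = O := by
  constructor
  · rintro ⟨hO, x, hx, rfl⟩
    exact ⟨x, ⟨hx, fun t ↦ hO (mem_range_self t)⟩, rfl⟩
  · rintro ⟨x, hx, rfl⟩
    exact ⟨range_subset_iff.2 hx.mem, x, hx.isSolution, rfl⟩

/-- Any two solutions tracing the orbit differ by a time shift, which does not affect the limit. -/
theorem IsInteriorSolution.originatesFrom_iff {κ : State} (hx : IsInteriorSolution lam gam x) :
    OriginatesFrom lam gam (range x) κ ↔ Tendsto x atBot (𝓝 κ) := by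
  refine ⟨fun ⟨y, hy, hyx, hyκ⟩ ↦ ?_, fun hκ ↦ ⟨x, hx.isSolution, rfl, hκ⟩⟩
  have hy' : IsInteriorSolution lam gam y := ⟨hy, fun t ↦ by
    obtain ⟨s, hs⟩ := hyx.le (mem_range_self t)
    exact hs ▸ hx.mem s⟩
  obtain ⟨s, hs⟩ := hyx.ge (mem_range_self 0)
  rw [hx.eq_shift_of_eq hy' hs.symm]
  exact tendsto_comp_add_atBot hyκ _

/-- The orbits from `κ` form a 1-parameter set if their parameters form an open interval. -/
theorem isOneParameterSet_of_sourceSet_eq (h : Admissible lam gam) {κ : State} (hab : a < b)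
    (hκ : sourceSet lam gam κ = Ioo a b) :
    IsOneParameterSet {O | IsInteriorOrbit lam gam O ∧ OriginatesFrom lam gam O κ} := by
  -- The sigmoid maps ℝ bijectively onto (0, 1), so the affine image runs through (a, b) exactly
  -- once.
  refine ⟨fun s ↦ sectionCurve lam (a + (b - a) * Real.sigmoid s),
    (continuous_levelCurve lam _).comp (by fun_prop), fun s ↦ ?_, ?_⟩
  · have hmem : a + (b - a) * Real.sigmoid s ∈ sourceSet lam gam κ := by
      rw [hκ]
      have h1 := Real.sigmoid_pos s
      have h2 := Real.sigmoid_lt_one s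
      constructor <;> nlinarith
    obtain ⟨x, hx, hxs, hxκ⟩ := hmem
    exact ⟨range x, ⟨isInteriorOrbit_iff.2 ⟨x, hx, rfl⟩, hx.originatesFrom_iff.2 hxκ⟩, 0, hxs⟩
  · rintro O ⟨hO, hOκ⟩
    obtain ⟨x, hx, rfl⟩ := isInteriorOrbit_iff.1 hO
    obtain ⟨t, ht, htc, -⟩ := hx.exists_sectionCurve h
    have hmem := (hx.tendsto_iff_mem_sourceSet htc).1 (hx.originatesFrom_iff.1 hOκ)
    rw [hκ] at hmem
    have hba : 0 < b - a := by linarith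
    obtain ⟨s, hs⟩ : ((x t).1 - a) / (b - a) ∈ range Real.sigmoid := by
      rw [Real.range_sigmoid]
      exact ⟨div_pos (by linarith [hmem.1]) hba,
        (div_lt_one hba).2 (by linarith [hmem.2])⟩
    have hs' : a + (b - a) * Real.sigmoid s = (x t).1 := by
      rw [hs]
      field_simp
      ring
    refine ⟨s, ⟨t, ?_⟩, ?_⟩
    · rw [htc]
      simp only [hs', ← htc]
    · rintro r ⟨t', ht'⟩
      simp only at ht'
      have hD : a + (b - a) * Real.sigmoid r ∈ sectionDomain lam := by
        rw [sectionDomain, mem_ofPred_eq, ← ht']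
        exact hx.mem t'
      have hZ : lyapunov lam (x t') = lyapunov lam (x t) := by
        rw [ht, ht', lyapunov_sectionCurve h hD]
      have htt := (hx.strictMono_lyapunov h).injective hZ
      rw [htt] at ht'
      have h1 : (x t).1 = a + (b - a) * Real.sigmoid r := congrArg Prod.fst ht'
      rw [← hs'] at h1
      exact (Real.sigmoid_injective (mul_left_cancel₀ hba.ne' (add_left_cancel h1))).symm

end ScalarFluid

open ScalarFluid in
theorem theorem1 (lam gam : ℝ) (hgam : gam ∈ Set.Ioo (0 : ℝ) 2) (h : lam ^ 2 / 3 ≤ gam) :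
    -- the interior is partitioned into interior orbits, all of them complete
    (∀ p ∈ interiorStates, ∃! O : Set State, IsInteriorOrbit lam gam O ∧ p ∈ O) ∧
    -- (i)
    ((∀ O : Set State, IsInteriorOrbit lam gam O → EndsAt lam gam O (P lam)) ∧
      (lam = 0 → P lam = dS) ∧ (gam = lam ^ 2 / 3 → P lam = S lam gam)) ∧
    -- (ii)
    (∃! O : Set State, IsInteriorOrbit lam gam O ∧ OriginatesFrom lam gam O FL) ∧
    -- (iii)
    ((∀ O : Set State, IsInteriorOrbit lam gam O → ¬ OriginatesFrom lam gam O FL →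
        OriginatesFrom lam gam O Kminus ∨ OriginatesFrom lam gam O Kplus) ∧
      IsOneParameterSet {O | IsInteriorOrbit lam gam O ∧ OriginatesFrom lam gam O Kminus} ∧
      IsOneParameterSet {O | IsInteriorOrbit lam gam O ∧ OriginatesFrom lam gam O Kplus}) := by
  have hA : Admissible lam gam := Admissible.mk' hgam h
  obtain ⟨a, c, b, hac, hcb, -, hminus, hFL, hplus⟩ := exists_sourceSet_eq hA
  refine ⟨fun p hp ↦ ?_, ⟨fun O hO ↦ ?_, ?_, ?_⟩, ?_, fun O hO hne ↦ ?_,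
    isOneParameterSet_of_sourceSet_eq hA hac hminus,
    isOneParameterSet_of_sourceSet_eq hA hcb hplus⟩
  · obtain ⟨x, hx, hx0⟩ := exists_isInteriorSolution hA hp
    refine ⟨Set.range x, ⟨isInteriorOrbit_iff.2 ⟨x, hx, rfl⟩, 0, hx0⟩, ?_⟩
    rintro O ⟨hO, hpO⟩
    obtain ⟨y, hy, rfl⟩ := isInteriorOrbit_iff.1 hO
    obtain ⟨t, ht⟩ := hpO
    exact hy.range_eq_of_eq hx (ht.trans hx0.symm)
  · obtain ⟨x, hx, rfl⟩ := isInteriorOrbit_iff.1 hO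
    exact ⟨x, hx.isSolution, rfl, hx.tendsto_P_atTop hA⟩
  · rintro rfl
    simp [P, dS]
  · intro hg
    have hlam : lam ≠ 0 := by
      rintro rfl
      norm_num at hg
      exact hgam.1.ne' hg
    have h1 : √(3 / 2) * (gam / lam) = lam / √6 := by
      rw [hg]
      have h2 : √(3 / 2) * lam = 3 * (lam / √6) := sqrt_mul_eq_slope lam
      rw [show √(3 / 2) * (lam ^ 2 / 3 / lam) = √(3 / 2) * lam / 3 by field_simp, h2]
      ring
    refine Prod.ext h1.symm ?_
    change 0 = 1 - 3 * gam / lam ^ 2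
    rw [hg]
    field_simp
    norm_num
  · obtain ⟨x, hx, hxc, hxF⟩ : c ∈ sourceSet lam gam FL := hFL ▸ Set.mem_singleton c
    refine ⟨Set.range x, ⟨isInteriorOrbit_iff.2 ⟨x, hx, rfl⟩, hx.originatesFrom_iff.2 hxF⟩, ?_⟩
    rintro O ⟨hO, hOF⟩
    obtain ⟨y, hy, rfl⟩ := isInteriorOrbit_iff.1 hO
    obtain ⟨t, s, hts⟩ := hy.exists_eq_of_tendsto_FL hA hx (hy.originatesFrom_iff.1 hOF) hxF
    exact hy.range_eq_of_eq hx hts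
  · obtain ⟨x, hx, rfl⟩ := isInteriorOrbit_iff.1 hO
    rw [hx.originatesFrom_iff] at hne
    rw [hx.originatesFrom_iff, hx.originatesFrom_iff]
    exact (hx.tendsto_atBot_trichotomy hA).imp_right fun h1 ↦ h1.resolve_left hne
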